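/- Let $D$ be the Scott domain given by the canonical (inverse-limit) solution of $$D = (\mathbf{Nil} + \mathbf{Left}(D) + \mathbf{Right}(D) + \mathbf{Pair}(D\times D) + \mathbf{Fun}(D\to D) + \mathbf{Amb}(D\times D))_\bot .$$ Elements of $D$ are denoted by programs of an untyped functional language with constructors, $\lambda$, application, recursion, $\bot$, and case expressions whose clauses $P\to N$ may have overlapping patterns $P$, provided that clauses are pairwise compatible (their bodies agree on common instances of the patterns). Types $\rho$ are built from type variables, $\mathbf 1$, $\times$, $+$, $\Rightarrow$, $\mathbf{fix}$ and $\mathbf A$, and are interpreted by subdomains of $D$; in particular $\mathbf 1=\{\bot,\mathbf{Nil}\}$ and $\mathbf A(\rho)=\{\bot\}\cup\{\mathbf{Amb}(a,b)\mid a,b\in\rho\}$. Consider many-sorted first-order formulas with strictly positive inductive and co-inductive predicates, extended by a restriction $A\,\|\,B$ and a concurrency modality $\downdownarrows(A)$. A formula is *Harrop* if it has no disjunction, restriction, modality $\downdownarrows$ or free predicate variable at a strictly positive position. It is *productive* if each of its implications and restrictions is part of a Harrop formula or of a disjunction and no free predicate variable stands, outside such parts, in it. Every formula $A$ has a type $\tau(A)$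 (with $\tau(A)=\mathbf 1$ for Harrop $A$, $\tau(A\,\|\,B)=\tau(A)$, $\tau(\downdownarrows(A))=\mathbf A(\tau(A))$) and a realisability interpretation $a\,\mathbf r\,A$, for $a\in D$, given by the usual clauses with quantifiers interpreted uniformly, with $a\,\mathbf r\,A\leftrightarrow a=\mathbf{Nil}\wedge\mathbf H(A)$ for Harrop $A$, and with $$a\,\mathbf r\,(A\,\|\,B) \;:\Leftrightarrow\; a:\tau(A)\wedge\bigl((\exists b)\,b\,\mathbf r\,B\to a\neq\bot\bigr)\wedge(a\neq\bot\to a\,\mathbf r\,A),$$ $$c\,\mathbf r\,\downdownarrows(A) \;:\Leftrightarrow\; (\exists a,b:\tau(A))\; c=\mathbf{Amb}(a,b)\wedge(a\neq\bot\vee b\neq\bot)\wedge(a\neq\bot\to a\,\mathbf r\,A)\wedge(b\neq\bot\to b\,\mathbf r\,A).$$ The rules for the concurrency modality are: * ($\downdownarrows$-lem) from $A\,\|\,C$ and $A\,\|\,\neg C$ infer $\downdownarrows(A)$; * ($\downdownarrows$-return) from $A$ infer $\downdownarrows(A)$; * ($\downdownarrows$-mon) from $\downdownarrows(A)$ and $A\to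 B$ infer $\downdownarrows(B)$; * ($\downdownarrows$-H) from $\downdownarrows(A)$ infer $A$, for Harrop $A$; * ($\downdownarrows$-$\|$-absorb) from $\downdownarrows(A\,\|\,B)$ infer $\downdownarrows(A)$; * ($\downdownarrows$-$\|$-$\vee$) from $A\,\|\,B$ and $C\,\|\,E$ infer $\downdownarrows(A\vee C)\,\|\,(B\vee E)$; * ($\downdownarrows$-$\|$-intro) from $B\to\downdownarrows(A_0\vee A_1)$ and $\neg B\to A_0\wedge A_1$ infer $\downdownarrows(A_0\vee A_1)\,\|\,B$, for Harrop $A_0,A_1,B$; where $A$, as well as $B$ in ($\downdownarrows$-mon) and $C$ in ($\downdownarrows$-$\|$-$\vee$), is required to be productive. A closed program $M$ *realises* a rule with premises $A_1,\dots,A_n$ and conclusion $C$ if, for every structure and every assignment (interpreting type variables by subdomains), the following holds: $M$, applied to elements of the types of the non-Harrop premises, yields an element of $\tau(C)$; and if $\mathbf H(A_i)$ holds for all Harrop premises, then $M$, applied to realisers $a_i:\tau(A_i)$ of the non-Harrop premises, yields a realiser of $C$. **Lemma.** All rules for the concurrency modality are realisable, i.e. every instance of a rule is realised by a closed program. More precisely,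 the following programs, independent of the formulas, realise the last three rules: 1. ($\downdownarrows$-$\|$-absorb) is realised by $\lambda c.\,c$. 2. ($\downdownarrows$-$\|$-$\vee$) is realised by $g=\lambda a.\lambda b.\,\mathbf{amb}_{\mathbf{LR}}(\mathbf{Left}{\downarrow}a,\mathbf{Right}{\downarrow}b)$, where $f{\downarrow}a$ is strict application and $\mathbf{amb}_{\mathbf{LR}}(u,v)$ is the program $\mathbf{case}\ \mathbf{Pair}(u,v)\ \mathbf{of}\ \{\mathbf{Pair}(\mathbf{Left}(\_),\_)\to\mathbf{Amb}(u,v);\ \mathbf{Pair}(\_,\mathbf{Right}(\_))\to\mathbf{Amb}(u,v)\}$. 3. ($\downdownarrows$-$\|$-intro) is realised by the program with overlapping case patterns $$h=\lambda c.\,\mathbf{case}\ c\ \mathbf{of}\ \{\mathbf{Amb}(K(\_),\_)\to c';\ \mathbf{Amb}(\_,K(\_))\to c' \mid K\in\{\mathbf{Left},\mathbf{Right}\}\},$$ where $c'=\mathbf{case}\ c\ \mathbf{of}\ \{\mathbf{Amb}(a,b)\to\mathbf{Amb}(\ell\,a,\ell\,b)\}$ and $\ell=\lambda d.\,\mathbf{case}\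 d\ \mathbf{of}\ \{\mathbf{Left}(\_)\to\mathbf{Left}(\mathbf{Nil});\ \mathbf{Right}(\_)\to\mathbf{Right}(\mathbf{Nil})\}$. Consequently, adding the rules for the concurrency modality preserves soundness: let $\mathcal K$ be any class of structures and let $\mathcal R$ be any calculus of sequents $\Gamma\vdash A$ of these formulas, each rule of which is realisable over $\mathcal K$ (if the premises are realised by programs, so is the conclusion). Then for every sequent $\Gamma\vdash A$ derivable in $\mathcal R$ extended by the rules above (with a common context $\Gamma$) there is a program $M$, with free variables $\vec u$ for the assumptions, such that in all structures of $\mathcal K$: $M:\tau(A)$ whenever $\vec u:\tau(\Gamma)$, and $M\,\mathbf r\,A$ whenever $\vec u:\tau(\Gamma)$ and $\vec u\,\mathbf r\,\Gamma$. -/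

import Mathlib

universe u v

namespace CFP

/-! ### The Scott domain of realisers -/

/-- One unfolding of the right-hand side of the domain equation
`D = (Nil + Left(D) + Right(D) + Pair(D × D) + Fun(D → D) + Amb(D × D))_⊥`,
with `X` in place of `D` and `E` in place of the space `D → D`. -/
inductive Layer (X E : Type) : Type
  | bot : Layer X E
  | nil : Layer X E
  | left (a : X) : Layer X E
  | right (a : X) : Layer X E
  | pair (a b : X) : Layer X E
  | func (f : E) : Layer X E
  | amb (a b : X) : Layer X E

namespace Layer

/-- The order of a lifted disjoint sum. -/
inductive Le {X E : Type} [LE X] [LE E] : Layer X E → Layer X E → Prop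
  | bot (y : Layer X E) : Le .bot y
  | nil : Le .nil .nil
  | left {a a' : X} : a ≤ a' → Le (.left a) (.left a')
  | right {a a' : X} : a ≤ a' → Le (.right a) (.right a')
  | pair {a a' b b' : X} : a ≤ a' → b ≤ b' → Le (.pair a b) (.pair a' b')
  | func {f f' : E} : f ≤ f' → Le (.func f) (.func f')
  | amb {a a' b b' : X} : a ≤ a' → b ≤ b' → Le (.amb a b) (.amb a' b')

instance {X E : Type} [PartialOrder X] [PartialOrder E] : PartialOrder (Layer X E) where
  le := Le
  le_refl x := by cases x <;> constructor <;> exact le_refl _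
  le_trans x y z h1 h2 := by
    cases h1 <;> cases h2 <;> constructor <;> exact le_trans (by assumption) (by assumption)
  le_antisymm x y h1 h2 := by
    cases h1 <;> cases h2 <;> congr 1 <;> exact le_antisymm (by assumption) (by assumption)

theorem le_def {X E : Type} [PartialOrder X] [PartialOrder E] (x y : Layer X E) :
    x ≤ y ↔ Le x y := Iff.rfl

def map {X E Y F : Type} (u : X → Y) (v : E → F) : Layer X E → Layer Y F
  | .bot => .bot
  | .nil => .nil
  | .left a => .left (u a)
  | .right a => .right (u a)
  | .pair a b => .pair (u a) (u b)
  | .func f => .func (v f)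
  | .amb a b => .amb (u a) (u b)

theorem map_mono {X E Y F : Type} [PartialOrder X] [PartialOrder E] [PartialOrder Y]
    [PartialOrder F] {u : X → Y} {v : E → F} (hu : Monotone u) (hv : Monotone v) :
    Monotone (map u v) := by
  intro x y h
  cases h <;> constructor <;> first | exact hu (by assumption) | exact hv (by assumption)

instance {X E : Type} [Finite X] [Finite E] : Finite (Layer X E) := by
  let g : Option (Option ((X ⊕ X) ⊕ ((X × X) ⊕ (X × X)) ⊕ E)) → Layer X E := fun o =>
    match o with
    | none => .bot
    | some none => .nil
    | some (some (.inl (.inl a))) => .left a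
    | some (some (.inl (.inr a))) => .right a
    | some (some (.inr (.inl (.inl p)))) => .pair p.1 p.2
    | some (some (.inr (.inl (.inr p)))) => .amb p.1 p.2
    | some (some (.inr (.inr f))) => .func f
  refine Finite.of_surjective g fun x => ?_
  cases x with
  | bot => exact ⟨none, rfl⟩
  | nil => exact ⟨some none, rfl⟩
  | left a => exact ⟨some (some (.inl (.inl a))), rfl⟩
  | right a => exact ⟨some (some (.inl (.inr a))), rfl⟩
  | pair a b => exact ⟨some (some (.inr (.inl (.inl (a, b))))), rfl⟩
  | func f => exact ⟨some (some (.inr (.inr f))), rfl⟩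
  | amb a b => exact ⟨some (some (.inr (.inl (.inr (a, b))))), rfl⟩

end Layer

/-- A finite partial order; on such orders every monotone map is continuous. -/
structure FinPoset where
  carrier : Type
  [order : PartialOrder carrier]
  [finite : Finite carrier]

attribute [instance] FinPoset.order FinPoset.finite

/-- Two monotone maps between `X` and `Y`, in opposite directions, induce a monotone map between
the unfoldings; a function `f` is sent to `a ∘ f ∘ b`. -/
def Layer.mapHom {X Y : Type} [PartialOrder X] [PartialOrder Y] (a : X →o Y) (b : Y →o X) :
    Layer X (X →o X) →o Layer Y (Y →o Y) where
  toFun := Layer.map a (fun f => (a.comp f).comp b)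
  monotone' := Layer.map_mono a.monotone fun _ _ h x => a.monotone (h (b x))

instance {X Y : Type} [PartialOrder X] [PartialOrder Y] [Finite X] [Finite Y] :
    Finite (X →o Y) := DFunLike.finite _

/-- The finite approximations of the domain: a point, then iterated unfoldings. -/
def approx : ℕ → FinPoset
  | 0 => ⟨PUnit⟩
  | n + 1 => ⟨Layer (approx n).carrier ((approx n).carrier →o (approx n).carrier)⟩

abbrev T (n : ℕ) : Type := (approx n).carrier

/-- The canonical maps between approximations, in both directions. For `n ≤ m` the first
component is the embedding of level `n` into level `m`, the second one the projection back. -/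
def transfer : ∀ n m : ℕ, (T n →o T m) × (T m →o T n)
  | 0, 0 => (OrderHom.id, OrderHom.id)
  | 0, _ + 1 => (⟨fun _ => Layer.bot, fun _ _ _ => Layer.Le.bot _⟩, ⟨fun _ => PUnit.unit, fun _ _ _ => le_refl _⟩)
  | _ + 1, 0 => (⟨fun _ => PUnit.unit, fun _ _ _ => le_refl _⟩, ⟨fun _ => Layer.bot, fun _ _ _ => Layer.Le.bot _⟩)
  | n + 1, m + 1 =>
    (Layer.mapHom (transfer n m).1 (transfer n m).2, Layer.mapHom (transfer n m).2 (transfer n m).1)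

/-- The canonical map from level `n` to level `m`. -/
def tr (n m : ℕ) : T n →o T m := (transfer n m).1

theorem transfer_swap (n m : ℕ) : (transfer n m).swap = transfer m n := by
  induction n generalizing m with
  | zero => cases m <;> rfl
  | succ n ih =>
    cases m with
    | zero => rfl
    | succ m =>
      have h := ih m
      simp only [transfer, ← h]
      rfl

theorem tr_succ (n m : ℕ) : tr (n + 1) (m + 1) = Layer.mapHom (tr n m) (tr m n) := by
  have h : tr m n = (transfer n m).2 := by rw [tr, ← transfer_swap n m]; rfl
  rw [h]; rfl

theorem tr_self (n : ℕ) (x : T n) : tr n n x = x := by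
  induction n with
  | zero => rfl
  | succ n ih =>
    rw [tr_succ]
    have h : ∀ y : Layer (T n) (T n →o T n), Layer.mapHom (tr n n) (tr n n) y = y := by
      intro y
      cases y <;> simp only [Layer.mapHom, OrderHom.coe_mk, Layer.map, ih]
      congr 1; ext z
      simp [ih]
    exact h x

theorem tr_tr (n m k : ℕ) (h : k ≤ m ∨ n ≤ m) (x : T n) : tr m k (tr n m x) = tr n k x := by
  induction m generalizing n k with
  | zero =>
    cases n with
    | zero => rw [tr_self]
    | succ n =>
      cases k with
      | zero => rfl
      | succ k => omega
  | succ m ih =>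
    cases n with
    | zero => cases k <;> rfl
    | succ n =>
      cases k with
      | zero => rfl
      | succ k =>
        simp only [tr_succ]
        have h' : k ≤ m ∨ n ≤ m := by omega
        have key : ∀ y : Layer (T n) (T n →o T n),
            Layer.mapHom (tr m k) (tr k m) (Layer.mapHom (tr n m) (tr m n) y) =
              Layer.mapHom (tr n k) (tr k n) y := by
          intro y
          cases y <;> simp only [Layer.mapHom, OrderHom.coe_mk, Layer.map, ih n k h']
          congr 1
          ext z
          simp [ih n k h', ih k n h'.symm]
        exact key x

theorem tr_tr_le (n m k : ℕ) (x : T n) : tr m k (tr n m x) ≤ tr n k x := by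
  induction m generalizing n k with
  | zero =>
    cases n with
    | zero => rw [tr_self]
    | succ n =>
      cases k with
      | zero => exact le_refl _
      | succ k => exact Layer.Le.bot _
  | succ m ih =>
    cases n with
    | zero => cases k <;> exact le_refl _
    | succ n =>
      cases k with
      | zero => exact le_refl _
      | succ k =>
        simp only [tr_succ]
        have key : ∀ y : Layer (T n) (T n →o T n),
            Layer.mapHom (tr m k) (tr k m) (Layer.mapHom (tr n m) (tr m n) y) ≤
              Layer.mapHom (tr n k) (tr k n) y := by
          intro y
          cases y with
          | bot => exact Layer.Le.bot _
          | nil => exact Layer.Le.nil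
          | left a => exact Layer.Le.left (ih n k a)
          | right a => exact Layer.Le.right (ih n k a)
          | pair a b => exact Layer.Le.pair (ih n k a) (ih n k b)
          | amb a b => exact Layer.Le.amb (ih n k a) (ih n k b)
          | func f =>
            refine Layer.Le.func fun z => ?_
            exact (ih n k _).trans ((tr n k).monotone (f.monotone (ih k n z)))
        exact key x

/-- The domain of realisers: the inverse limit of the finite approximations along the
projections, i.e. the canonical solution of the domain equation. -/
structure D : Type where
  val : ∀ n, T n
  compat : ∀ m n, m ≤ n → tr n m (val n) = val m

namespace D

theorem ext {x y : D} (h : ∀ n, x.val n = y.val n) : x = y := by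
  cases x; cases y; congr; exact funext h

instance : PartialOrder D where
  le x y := ∀ n, x.val n ≤ y.val n
  le_refl x n := le_refl _
  le_trans x y z h1 h2 n := (h1 n).trans (h2 n)
  le_antisymm x y h1 h2 := ext fun n => le_antisymm (h1 n) (h2 n)

theorem le_def (x y : D) : x ≤ y ↔ ∀ n, x.val n ≤ y.val n := Iff.rfl

/-- The embedding of the `n`-th approximation into the domain. -/
def emb (n : ℕ) (x : T n) : D where
  val m := tr n m x
  compat m k h := tr_tr n k m (Or.inl h) x

theorem emb_mono (n : ℕ) : Monotone (emb n) := fun _ _ h m => (tr n m).monotone h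

theorem emb_val_self (n : ℕ) (x : T n) : (emb n x).val n = x := tr_self n x

theorem emb_val_le (n : ℕ) (d : D) : emb n (d.val n) ≤ d := by
  intro m
  change tr n m (d.val n) ≤ d.val m
  rcases le_total m n with h | h
  · rw [d.compat m n h]
  · rw [← d.compat n m h]
    exact (tr_tr_le m n m _).trans (le_of_eq (tr_self m _))

/-- Directed sets have a supremum, which is attained at every level. -/
theorem exists_lub {S : Set D} (hne : S.Nonempty) (hS : DirectedOn (· ≤ ·) S) :
    ∃ s : D, IsLUB S s ∧ ∀ n, ∃ d ∈ S, d.val n = s.val n := by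
  have h1 : ∀ n, ∃ d ∈ S, ∀ d' ∈ S, d'.val n ≤ d.val n := by
    intro n
    obtain ⟨d, hd, hmax⟩ :=
      (Set.toFinite ((fun d : D => d.val n) '' S)).exists_maximalFor id _ (hne.image _)
    obtain ⟨d0, hd0, rfl⟩ := hd
    refine ⟨d0, hd0, fun d' hd' => ?_⟩
    obtain ⟨e, he, h1, h2⟩ := hS d0 hd0 d' hd'
    exact (h2 n).trans (hmax ⟨e, he, rfl⟩ (h1 n))
  choose g hg hgm using h1
  have hc : ∀ m n, m ≤ n → tr n m ((g n).val n) = (g m).val m := by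
    intro m n h
    apply le_antisymm
    · rw [(g n).compat m n h]; exact hgm m _ (hg n)
    · rw [← (g m).compat m n h]; exact (tr n m).monotone (hgm n _ (hg m))
  refine ⟨⟨fun n => (g n).val n, hc⟩, ⟨fun d hd n => hgm n d hd, fun u hu n => hu (hg n) n⟩,
    fun n => ⟨g n, hg n, rfl⟩⟩

theorem attained {S : Set D} (hne : S.Nonempty) (hS : DirectedOn (· ≤ ·) S) {s : D}
    (hs : IsLUB S s) (n : ℕ) : ∃ d ∈ S, d.val n = s.val n := by
  obtain ⟨s', hs', h⟩ := exists_lub hne hS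
  rw [hs.unique hs']; exact h n

/-- The space `D → D` of Scott continuous functions, ordered pointwise. -/
abbrev Cont : Type := {f : D → D // ScottContinuous f}

/-- The `n`-th approximation of a continuous function. -/
def Cont.approx (f : Cont) (n : ℕ) : T n →o T n where
  toFun x := (f.1 (emb n x)).val n
  monotone' _ _ h := f.2.monotone (emb_mono n h) n

theorem Cont.tr_approx (f : Cont) (m n : ℕ) (h : m ≤ n) :
    ((tr n m).comp (f.approx n)).comp (tr m n) = f.approx m := by
  ext x
  have e : emb n (tr m n x) = emb m x := ext fun k => tr_tr m n k (Or.inr h) x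
  change tr n m ((f.1 (emb n (tr m n x))).val n) = (f.1 (emb m x)).val m
  rw [e, D.compat _ m n h]

def foldVal (y : Layer D Cont) : ∀ n, T n
  | 0 => PUnit.unit
  | n + 1 => Layer.map (fun d => d.val n) (fun f => f.approx n) y

/-- The folding map from the right-hand side of the domain equation to `D`. -/
def fold (y : Layer D Cont) : D where
  val := foldVal y
  compat m n h := by
    cases m with
    | zero => rfl
    | succ m =>
      cases n with
      | zero => omega
      | succ n =>
        have h' : m ≤ n := by omega
        rw [tr_succ]
        have key : Layer.mapHom (tr n m) (tr m n)
            (Layer.map (fun d : D => d.val n) (fun f : Cont => f.approx n) y) =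
              Layer.map (fun d : D => d.val m) (fun f : Cont => f.approx m) y := by
          cases y <;> simp only [Layer.mapHom, OrderHom.coe_mk, Layer.map,
            D.compat _ m n h', Cont.tr_approx _ m n h']
        exact key

theorem Cont.le_of_approx (f g : Cont) (h : ∀ n, f.approx n ≤ g.approx n) : f ≤ g := by
  intro d
  have hdir : DirectedOn (· ≤ ·) (Set.range fun n => emb n (d.val n)) := by
    rintro _ ⟨n, rfl⟩ _ ⟨m, rfl⟩
    have key : ∀ a b, a ≤ b → emb a (d.val a) ≤ emb b (d.val b) := by
      intro a b hab k
      change tr a k (d.val a) ≤ tr b k (d.val b)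
      rw [← d.compat a b hab]
      exact tr_tr_le b a k _
    exact ⟨_, ⟨max n m, rfl⟩, key _ _ (le_max_left _ _), key _ _ (le_max_right _ _)⟩
  have hlub : IsLUB (Set.range fun n => emb n (d.val n)) d := by
    constructor
    · rintro _ ⟨n, rfl⟩; exact emb_val_le n d
    · intro u hu n
      have := hu ⟨n, rfl⟩ n
      rwa [emb_val_self] at this
  refine (f.2 (Set.range_nonempty _) hdir hlub).2 ?_
  rintro _ ⟨_, ⟨n, rfl⟩, rfl⟩ m
  set k := max n m with hk
  have e : emb n (d.val n) ≤ emb k (d.val k) := by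
    intro j
    change tr n j (d.val n) ≤ tr k j (d.val k)
    rw [← d.compat n k (le_max_left _ _)]
    exact tr_tr_le k n j _
  have h1 : (f.1 (emb n (d.val n))).val k ≤ (g.1 d).val k :=
    (f.2.monotone e k).trans ((h k (d.val k)).trans (g.2.monotone (emb_val_le k d) k))
  have h2 := (tr k m).monotone h1
  rwa [D.compat _ m k (le_max_right _ _), D.compat _ m k (le_max_right _ _)] at h2

theorem fold_le_fold (y z : Layer D Cont) : fold y ≤ fold z ↔ y ≤ z := by
  constructor
  · intro h
    have h' : ∀ n, Layer.Le (Layer.map (fun d : D => d.val n) (fun f : Cont => f.approx n) y)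
        (Layer.map (fun d : D => d.val n) (fun f : Cont => f.approx n) z) := fun n => h (n + 1)
    clear h
    cases y <;> cases z <;> simp only [Layer.map] at h' <;>
      first
      | exact Layer.Le.bot _
      | exact Layer.Le.nil
      | (exfalso; cases h' 0; done)
      | (refine Layer.Le.left fun n => ?_; cases h' n; assumption)
      | (refine Layer.Le.right fun n => ?_; cases h' n; assumption)
      | (refine Layer.Le.pair (fun n => ?_) (fun n => ?_) <;> (cases h' n; assumption))
      | (refine Layer.Le.amb (fun n => ?_) (fun n => ?_) <;> (cases h' n; assumption))
      | (refine Layer.Le.func (Cont.le_of_approx _ _ fun n => ?_); cases h' n; assumption)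
  · intro h n
    cases n with
    | zero => exact le_refl _
    | succ n =>
      exact Layer.map_mono (u := fun d : D => d.val n) (v := fun f : Cont => f.approx n)
        (fun a b (h : ∀ n, a.val n ≤ b.val n) => h n)
        (fun f g (h : ∀ d, f.1 d ≤ g.1 d) x => h (emb n x) n) h

theorem exists_sup_chain (c : ℕ → D) (hc : Monotone c) :
    ∃ s : D, IsLUB (Set.range c) s ∧ ∀ n, ∃ k, (c k).val n = s.val n := by
  obtain ⟨s, hs, h⟩ := exists_lub (Set.range_nonempty c) (directedOn_range.2 hc.directed_le)
  refine ⟨s, hs, fun n => ?_⟩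
  obtain ⟨_, ⟨k, rfl⟩, hk⟩ := h n
  exact ⟨k, hk⟩

/-- A compatible family of maps between the approximations determines a continuous function. -/
theorem exists_cont (f : ∀ n, T n →o T n)
    (hf : ∀ m n, m ≤ n → ((tr n m).comp (f n)).comp (tr m n) = f m) :
    ∃ F : Cont, ∀ n, F.approx n = f n := by
  have hfx : ∀ m n, m ≤ n → ∀ x, tr n m (f n (tr m n x)) = f m x := fun m n h x => by
    rw [← hf m n h]; rfl
  have hmono : ∀ d : D, Monotone fun n => emb n (f n (d.val n)) := by
    intro d m n h k
    change tr m k (f m (d.val m)) ≤ tr n k (f n (d.val n))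
    rw [← hfx m n h]
    refine (tr_tr_le n m k _).trans ((tr n k).monotone ((f n).monotone ?_))
    rw [← d.compat m n h]
    exact (tr_tr_le n m n _).trans (le_of_eq (tr_self n _))
  choose F hF hFa using fun d : D => exists_sup_chain _ (hmono d)
  have hFmono : Monotone F := by
    intro d e h
    refine (hF d).2 ?_
    rintro _ ⟨n, rfl⟩
    exact le_trans (emb_mono n ((f n).monotone (h n))) ((hF e).1 ⟨n, rfl⟩)
  have hFc : ScottContinuous F := by
    intro S hne hdir s hs
    constructor
    · rintro _ ⟨d, hd, rfl⟩
      exact hFmono (hs.1 hd)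
    · intro u hu
      refine (hF s).2 ?_
      rintro _ ⟨n, rfl⟩
      obtain ⟨d, hd, hdn⟩ := attained hne hdir hs n
      simp only [← hdn]
      exact le_trans ((hF d).1 ⟨n, rfl⟩) (hu ⟨d, hd, rfl⟩)
  refine ⟨⟨F, hFc⟩, fun m => ?_⟩
  ext x
  change (F (emb m x)).val m = f m x
  apply le_antisymm
  · obtain ⟨n, hn⟩ := hFa (emb m x) m
    rw [← hn]
    change tr n m (f n (tr m n x)) ≤ f m x
    rcases le_total m n with h | h
    · rw [hfx m n h]
    · rw [← hfx n m h]
      refine (tr_tr_le m n m _).trans ((le_of_eq (tr_self m _)).trans ((f m).monotone ?_))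
      exact (tr_tr_le m n m _).trans (le_of_eq (tr_self m _))
  · have h := (hF (emb m x)).1 ⟨m, rfl⟩ m
    simp only [emb_val_self] at h
    exact h

theorem exists_of_compat (c : ∀ n, T n) (h : ∀ m n, m ≤ n → tr n m (c n) = c m) :
    ∃ d : D, ∀ n, d.val n = c n := ⟨⟨c, h⟩, fun _ => rfl⟩

theorem fold_surjective : Function.Surjective fold := by
  intro x
  let y : ∀ n, Layer (T n) (T n →o T n) := fun n => x.val (n + 1)
  have hy : ∀ m n, m ≤ n → Layer.map (tr n m) (fun f => ((tr n m).comp f).comp (tr m n)) (y n)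
      = y m := by
    intro m n h
    have := x.compat (m + 1) (n + 1) (by omega)
    rw [tr_succ] at this
    exact this
  suffices h : ∃ z, ∀ n, Layer.map (fun d : D => d.val n) (fun f : Cont => f.approx n) z = y n by
    obtain ⟨z, hz⟩ := h
    refine ⟨z, ext fun n => ?_⟩
    cases n with
    | zero => rfl
    | succ n => exact hz n
  have h0 := fun n => hy 0 n (Nat.zero_le n)
  cases e : y 0 with
  | bot =>
    refine ⟨.bot, fun n => ?_⟩
    have := h0 n
    rw [e] at this
    cases en : y n <;> simp [en, Layer.map] at this ⊢
  | nil =>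
    refine ⟨.nil, fun n => ?_⟩
    have := h0 n
    rw [e] at this
    cases en : y n <;> simp [en, Layer.map] at this ⊢
  | left a =>
    have : ∀ n, ∃ b, y n = .left b := by
      intro n
      have := h0 n
      rw [e] at this
      cases en : y n <;> simp [en, Layer.map] at this ⊢
    choose b hb using this
    obtain ⟨d, hd⟩ := exists_of_compat b fun m n h => by simpa [hb, Layer.map] using hy m n h
    exact ⟨.left d, fun n => by simp [Layer.map, hd, hb]⟩
  | right a =>
    have : ∀ n, ∃ b, y n = .right b := by
      intro n
      have := h0 n
      rw [e] at this
      cases en : y n <;> simp [en, Layer.map] at this ⊢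
    choose b hb using this
    obtain ⟨d, hd⟩ := exists_of_compat b fun m n h => by simpa [hb, Layer.map] using hy m n h
    exact ⟨.right d, fun n => by simp [Layer.map, hd, hb]⟩
  | pair a a' =>
    have : ∀ n, ∃ b c, y n = .pair b c := by
      intro n
      have := h0 n
      rw [e] at this
      cases en : y n <;> simp [en, Layer.map] at this ⊢
    choose b c hb using this
    obtain ⟨d, hd⟩ := exists_of_compat b fun m n h => by
      have := hy m n h
      simp only [hb, Layer.map, Layer.pair.injEq] at this
      exact this.1
    obtain ⟨d', hd'⟩ := exists_of_compat c fun m n h => by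
      have := hy m n h
      simp only [hb, Layer.map, Layer.pair.injEq] at this
      exact this.2
    exact ⟨.pair d d', fun n => by simp [Layer.map, hd, hd', hb]⟩
  | amb a a' =>
    have : ∀ n, ∃ b c, y n = .amb b c := by
      intro n
      have := h0 n
      rw [e] at this
      cases en : y n <;> simp [en, Layer.map] at this ⊢
    choose b c hb using this
    obtain ⟨d, hd⟩ := exists_of_compat b fun m n h => by
      have := hy m n h
      simp only [hb, Layer.map, Layer.amb.injEq] at this
      exact this.1
    obtain ⟨d', hd'⟩ := exists_of_compat c fun m n h => by
      have := hy m n h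
      simp only [hb, Layer.map, Layer.amb.injEq] at this
      exact this.2
    exact ⟨.amb d d', fun n => by simp [Layer.map, hd, hd', hb]⟩
  | func f =>
    have : ∀ n, ∃ b, y n = .func b := by
      intro n
      have := h0 n
      rw [e] at this
      cases en : y n <;> simp [en, Layer.map] at this ⊢
    choose b hb using this
    obtain ⟨F, hF⟩ := exists_cont b fun m n h => by simpa [hb, Layer.map] using hy m n h
    exact ⟨.func F, fun n => by simp [Layer.map, hF, hb]⟩

/-- The domain equation. -/
noncomputable def foldIso : Layer D Cont ≃o D :=
  RelIso.ofSurjective (OrderEmbedding.ofMapLEIff fold fold_le_fold) fold_surjective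

open Classical in
/-- Suprema (with a junk value for sets without a supremum). -/
noncomputable instance : SupSet D where
  sSup S := if h : ∃ s, IsLUB S s then h.choose else fold .bot

instance : OrderBot D where
  bot := fold .bot
  bot_le x := by
    obtain ⟨z, rfl⟩ := fold_surjective x
    exact (fold_le_fold _ _).2 (Layer.Le.bot z)

/-- The domain is a directed-complete partial order with least element. -/
noncomputable instance : CompletePartialOrder D where
  lubOfDirected S hS := by
    have h : ∃ s, IsLUB S s := by
      rcases S.eq_empty_or_nonempty with rfl | hne
      · exact ⟨⊥, isLUB_empty⟩
      · obtain ⟨s, hs, -⟩ := exists_lub hne hS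
        exact ⟨s, hs⟩
    have e : sSup S = h.choose := dif_pos h
    rw [e]
    exact h.choose_spec

/-! Constructors, application and recursion -/

def Nil : D := fold .nil
def Left (a : D) : D := fold (.left a)
def Right (a : D) : D := fold (.right a)
def Pair (a b : D) : D := fold (.pair a b)
def Amb (a b : D) : D := fold (.amb a b)
def Fun (f : Cont) : D := fold (.func f)

/-- `a b = f b` if `a = Fun f`, and `a b = ⊥` otherwise. -/
noncomputable def app (a b : D) : D :=
  match foldIso.symm a with
  | .func f => f.1 b
  | _ => ⊥

/-- Abstraction; only used for continuous `f` (the value is `⊥` otherwise). -/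
noncomputable def abs (f : D → D) : D :=
  open Classical in if h : ScottContinuous f then Fun ⟨f, h⟩ else ⊥

/-- The least fixed point of `app d`, as the supremum of its iterates. -/
noncomputable def fix (d : D) : D := sSup (Set.range fun n : ℕ => (app d)^[n] ⊥)

end D

/-! ### Programs -/

/-- Constructor patterns. Every `var` is a new variable; the variables of a pattern are numbered
from left to right, starting with `0`. -/
inductive CPat : Type
  | var : CPat
  | nil : CPat
  | left (p : CPat) : CPat
  | right (p : CPat) : CPat
  | pair (p q : CPat) : CPat
  | amb (p q : CPat) : CPat

/-- Patterns: constructor patterns and the function pattern `fun(a)`. -/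
inductive Pat : Type
  | con (p : CPat) : Pat
  | func : Pat

def CPat.arity : CPat → ℕ
  | .var => 1
  | .nil => 0
  | .left p => p.arity
  | .right p => p.arity
  | .pair p q => p.arity + q.arity
  | .amb p q => p.arity + q.arity

def Pat.arity : Pat → ℕ
  | .con p => p.arity
  | .func => 1

/-- Programs, with de Bruijn indices for the program variables (so that programs that are equal
up to renaming of bound variables are equal). In `case M n P N` the clauses are `P i → N i`; the
body `N i` is in the scope of `(P i).arity` new variables. -/
inductive Prog : Type
  | var (i : ℕ) : Prog
  | nil : Prog
  | left (M : Prog) : Prog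
  | right (M : Prog) : Prog
  | pair (M N : Prog) : Prog
  | amb (M N : Prog) : Prog
  | case (M : Prog) (n : ℕ) (P : Fin n → Pat) (N : Fin n → Prog) : Prog
  | lam (M : Prog) : Prog
  | app (M N : Prog) : Prog
  | fix (M : Prog) : Prog
  | bot : Prog

namespace Prog

/-- The free variables of the program are among `0, …, k - 1`. -/
def ClosedAt : ℕ → Prog → Prop
  | k, var i => i < k
  | _, nil => True
  | k, left M => M.ClosedAt k
  | k, right M => M.ClosedAt k
  | k, pair M N => M.ClosedAt k ∧ N.ClosedAt k
  | k, amb M N => M.ClosedAt k ∧ N.ClosedAt k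
  | k, case M _ P N => M.ClosedAt k ∧ ∀ i, (N i).ClosedAt (k + (P i).arity)
  | k, lam M => M.ClosedAt (k + 1)
  | k, app M N => M.ClosedAt k ∧ N.ClosedAt k
  | k, fix M => M.ClosedAt k
  | _, bot => True

/-- A renaming under `k` binders. -/
def liftRen (k : ℕ) (f : ℕ → ℕ) (i : ℕ) : ℕ := if i < k then i else f (i - k) + k

def rename : (ℕ → ℕ) → Prog → Prog
  | f, var i => var (f i)
  | _, nil => nil
  | f, left M => left (M.rename f)
  | f, right M => right (M.rename f)
  | f, pair M N => pair (M.rename f) (N.rename f)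
  | f, amb M N => amb (M.rename f) (N.rename f)
  | f, case M n P N => case (M.rename f) n P fun i => (N i).rename (liftRen (P i).arity f)
  | f, lam M => lam (M.rename (liftRen 1 f))
  | f, app M N => app (M.rename f) (N.rename f)
  | f, fix M => fix (M.rename f)
  | _, bot => bot

/-- Weakening by `k` new variables. -/
def shift (k : ℕ) (M : Prog) : Prog := M.rename (· + k)

/-- A substitution under `k` binders. -/
def liftSub (k : ℕ) (σ : ℕ → Prog) (i : ℕ) : Prog := if i < k then var i else (σ (i - k)).shift k

def subst : (ℕ → Prog) → Prog → Prog
  | σ, var i => σ i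
  | _, nil => nil
  | σ, left M => left (M.subst σ)
  | σ, right M => right (M.subst σ)
  | σ, pair M N => pair (M.subst σ) (N.subst σ)
  | σ, amb M N => amb (M.subst σ) (N.subst σ)
  | σ, case M n P N => case (M.subst σ) n P fun i => (N i).subst (liftSub (P i).arity σ)
  | σ, lam M => lam (M.subst (liftSub 1 σ))
  | σ, app M N => app (M.subst σ) (N.subst σ)
  | σ, fix M => fix (M.subst σ)
  | _, bot => bot

/-- Simultaneous substitution of the first `θ.length` variables by `θ`. -/
def inst (θ : List Prog) (M : Prog) : Prog :=
  M.subst fun i => if h : i < θ.length then θ[i] else var (i - θ.length)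

end Prog

/-- The matching substitution of a program with a constructor pattern, if it exists. -/
def CPat.progMatch : CPat → Prog → Option (List Prog)
  | .var, M => some [M]
  | .nil, .nil => some []
  | .left p, .left M => p.progMatch M
  | .right p, .right M => p.progMatch M
  | .pair p q, .pair M N => (p.progMatch M).bind fun θ => (q.progMatch N).map fun θ' => θ ++ θ'
  | .amb p q, .amb M N => (p.progMatch M).bind fun θ => (q.progMatch N).map fun θ' => θ ++ θ'
  | _, _ => none

/-- The function pattern matches exactly the abstractions. -/
def Pat.progMatch : Pat → Prog → Option (List Prog)
  | .con p, M => p.progMatch M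
  | .func, .lam M => some [.lam M]
  | .func, _ => none

/-- Compatibility of clauses: on common instances of the patterns the bodies agree. -/
def Compatible (P₁ : Pat) (N₁ : Prog) (P₂ : Pat) (N₂ : Prog) : Prop :=
  ∀ M θ₁ θ₂, P₁.progMatch M = some θ₁ → P₂.progMatch M = some θ₂ → N₁.inst θ₁ = N₂.inst θ₂

/-- All clauses of all case constructs are pairwise compatible. -/
def Prog.Wf : Prog → Prop
  | .var _ => True
  | .nil => True
  | .left M => M.Wf
  | .right M => M.Wf
  | .pair M N => M.Wf ∧ N.Wf
  | .amb M N => M.Wf ∧ N.Wf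
  | .case M _ P N => M.Wf ∧ (∀ i, (N i).Wf) ∧ ∀ i j, Compatible (P i) (N i) (P j) (N j)
  | .lam M => M.Wf
  | .app M N => M.Wf ∧ N.Wf
  | .fix M => M.Wf
  | .bot => True

/-- `p.Matches d l`: the domain element `d` matches the constructor pattern `p` with matching
environment `l` (the list of values of the variables of `p`). -/
def CPat.Matches : CPat → D → List D → Prop
  | .var, d, l => l = [d]
  | .nil, d, l => d = D.Nil ∧ l = []
  | .left p, d, l => ∃ a, d = D.Left a ∧ p.Matches a l
  | .right p, d, l => ∃ a, d = D.Right a ∧ p.Matches a l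
  | .pair p q, d, l =>
    ∃ a b la lb, d = D.Pair a b ∧ p.Matches a la ∧ q.Matches b lb ∧ l = la ++ lb
  | .amb p q, d, l =>
    ∃ a b la lb, d = D.Amb a b ∧ p.Matches a la ∧ q.Matches b lb ∧ l = la ++ lb

def Pat.Matches : Pat → D → List D → Prop
  | .con p, d, l => p.Matches d l
  | .func, d, l => (∃ f, d = D.Fun f) ∧ l = [d]

/-- Overriding an environment: the first `l.length` variables get the values `l`. -/
def extend (l : List D) (η : ℕ → D) (i : ℕ) : D :=
  if h : i < l.length then l[i] else η (i - l.length)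

open Classical in
/-- The denotation of a program. In a case construct some matching clause is taken; by
compatibility of the clauses the value does not depend on which one. -/
noncomputable def Prog.denote : Prog → (ℕ → D) → D
  | .var i, η => η i
  | .nil, _ => D.Nil
  | .left M, η => D.Left (M.denote η)
  | .right M, η => D.Right (M.denote η)
  | .pair M N, η => D.Pair (M.denote η) (N.denote η)
  | .amb M N, η => D.Amb (M.denote η) (N.denote η)
  | .case M n P N, η =>
    if h : ∃ c : Fin n × List D, (P c.1).Matches (M.denote η) c.2 then
      (N h.choose.1).denote (extend h.choose.2 η)
    else ⊥
  | .lam M, η => D.abs fun d => M.denote (extend [d] η)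
  | .app M N, η => D.app (M.denote η) (N.denote η)
  | .fix M, η => D.fix (M.denote η)
  | .bot, _ => ⊥

/-! ### Types -/

/-- Types, with type variables from `V`. -/
inductive Ty (V : Type*) : Type _
  | var (X : V) : Ty V
  | one : Ty V
  | prod (ρ σ : Ty V) : Ty V
  | sum (ρ σ : Ty V) : Ty V
  | arrow (ρ σ : Ty V) : Ty V
  | fix (X : V) (ρ : Ty V) : Ty V
  | amb (ρ : Ty V) : Ty V

/-- Subdomains of `D`: downward closed subsets closed under all suprema that exist in `D`
(in particular they contain `⊥`). -/
def IsSubdomain (X : Set D) : Prop :=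
  IsLowerSet X ∧ ∀ S ⊆ X, ∀ d, IsLUB S d → d ∈ X

open Classical in
/-- The interpretation of types by subdomains. -/
def Ty.interp {V : Type*} : Ty V → (V → Set D) → Set D
  | .var X, ζ => ζ X
  | .one, _ => {⊥, D.Nil}
  | .prod ρ σ, ζ => {d | d = ⊥ ∨ ∃ a ∈ ρ.interp ζ, ∃ b ∈ σ.interp ζ, d = D.Pair a b}
  | .sum ρ σ, ζ => {d | d = ⊥ ∨ (∃ a ∈ ρ.interp ζ, d = D.Left a) ∨ ∃ b ∈ σ.interp ζ, d = D.Right b}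
  | .arrow ρ σ, ζ => {d | d = ⊥ ∨ ∃ f, d = D.Fun f ∧ ∀ a ∈ ρ.interp ζ, f.1 a ∈ σ.interp ζ}
  | .fix X ρ, ζ =>
    {d | ∀ Z, IsSubdomain Z → ρ.interp (Function.update ζ X Z) ⊆ Z → d ∈ Z}
  | .amb ρ, ζ => {d | d = ⊥ ∨ ∃ a ∈ ρ.interp ζ, ∃ b ∈ ρ.interp ζ, d = D.Amb a b}

/-! ### Formulas and predicates -/



/-- A many-sorted first-order signature with function symbols and predicate constants. -/
structure Signature where
  Srt : Type u
  Fn : Type u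
  dom : Fn → List Srt
  cod : Fn → Srt
  Rel : Type u
  arity : Rel → List Srt

/-- Object variables: a sort and a number. -/
abbrev OVar (Sg : Signature.{u}) : Type u := Sg.Srt × ℕ

/-- Predicate variables: an arity and a number. -/
abbrev PVar (Sg : Signature.{u}) : Type u := List Sg.Srt × ℕ

mutual
/-- Terms of a given sort. -/
inductive Term (Sg : Signature.{u}) : Sg.Srt → Type u
  | var (x : OVar Sg) : Term Sg x.1
  | app (f : Sg.Fn) (ts : Terms Sg (Sg.dom f)) : Term Sg (Sg.cod f)

/-- Tuples of terms. -/
inductive Terms (Sg : Signature.{u}) : List Sg.Srt → Type u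
  | nil : Terms Sg []
  | cons {s : Sg.Srt} {ar : List Sg.Srt} (t : Term Sg s) (ts : Terms Sg ar) : Terms Sg (s :: ar)
end

mutual
/-- Formulas; `restr A B` is the restriction `A ‖ B`, `conc A` the concurrency modality `⇊(A)`. -/
inductive Fml (Sg : Signature.{u}) : Type u
  | eq {s : Sg.Srt} (t t' : Term Sg s) : Fml Sg
  | app {ar : List Sg.Srt} (P : Pred Sg ar) (ts : Terms Sg ar) : Fml Sg
  | and (A B : Fml Sg) : Fml Sg
  | or (A B : Fml Sg) : Fml Sg
  | imp (A B : Fml Sg) : Fml Sg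
  | all (x : OVar Sg) (A : Fml Sg) : Fml Sg
  | ex (x : OVar Sg) (A : Fml Sg) : Fml Sg
  | restr (A B : Fml Sg) : Fml Sg
  | conc (A : Fml Sg) : Fml Sg

/-- Predicates of a given arity: variables, constants, abstractions, and the least and greatest
fixed points `μ (λ X. P)`, `ν (λ X. P)`. -/
inductive Pred (Sg : Signature.{u}) : List Sg.Srt → Type u
  | var (X : PVar Sg) : Pred Sg X.1
  | const (r : Sg.Rel) : Pred Sg (Sg.arity r)
  | abs (xs : List (OVar Sg)) (A : Fml Sg) : Pred Sg (xs.map Prod.fst)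
  | mu (X : PVar Sg) (P : Pred Sg X.1) : Pred Sg X.1
  | nu (X : PVar Sg) (P : Pred Sg X.1) : Pred Sg X.1
end

variable {Sg : Signature.{u}}

/-- Falsity `μ (λ X. X) ()`. -/
def Fml.false : Fml Sg := .app (.mu ([], 0) (.var ([], 0))) .nil

def Fml.neg (A : Fml Sg) : Fml Sg := .imp A .false

mutual
/-- The predicate variable `X` occurs free. -/
def Fml.Occurs (X : PVar Sg) : Fml Sg → Prop
  | .eq _ _ => False
  | .app P _ => P.Occurs X
  | .and A B => A.Occurs X ∨ B.Occurs X
  | .or A B => A.Occurs X ∨ B.Occurs X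
  | .imp A B => A.Occurs X ∨ B.Occurs X
  | .all _ A => A.Occurs X
  | .ex _ A => A.Occurs X
  | .restr A B => A.Occurs X ∨ B.Occurs X
  | .conc A => A.Occurs X

def Pred.Occurs (X : PVar Sg) : {ar : List Sg.Srt} → Pred Sg ar → Prop
  | _, .var Y => Y = X
  | _, .const _ => False
  | _, .abs _ A => A.Occurs X
  | _, .mu Y P => Y ≠ X ∧ P.Occurs X
  | _, .nu Y P => Y ≠ X ∧ P.Occurs X
end

mutual
/-- All free occurrences of `X` are strictly positive: not in the premise of an implication
and not in the condition of a restriction. -/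
def Fml.StrictlyPositive (X : PVar Sg) : Fml Sg → Prop
  | .eq _ _ => True
  | .app P _ => P.StrictlyPositive X
  | .and A B => A.StrictlyPositive X ∧ B.StrictlyPositive X
  | .or A B => A.StrictlyPositive X ∧ B.StrictlyPositive X
  | .imp A B => ¬ A.Occurs X ∧ B.StrictlyPositive X
  | .all _ A => A.StrictlyPositive X
  | .ex _ A => A.StrictlyPositive X
  | .restr A B => A.StrictlyPositive X ∧ ¬ B.Occurs X
  | .conc A => A.StrictlyPositive X

def Pred.StrictlyPositive (X : PVar Sg) : {ar : List Sg.Srt} → Pred Sg ar → Prop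
  | _, .var _ => True
  | _, .const _ => True
  | _, .abs _ A => A.StrictlyPositive X
  | _, .mu Y P => Y = X ∨ P.StrictlyPositive X
  | _, .nu Y P => Y = X ∨ P.StrictlyPositive X
end

open Classical in
mutual
/-- `A.Harrop F`: the formula `A` is Harrop when the predicate variables in `F` are regarded as
predicate constants, i.e. at strictly positive positions `A` contains no disjunction, restriction
or concurrency modality and no free predicate variable outside `F`. -/
def Fml.Harrop : (PVar Sg → Prop) → Fml Sg → Prop
  | _, .eq _ _ => True
  | F, .app P _ => P.Harrop F
  | F, .and A B => A.Harrop F ∧ B.Harrop F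
  | _, .or _ _ => False
  | F, .imp _ B => B.Harrop F
  | F, .all _ A => A.Harrop F
  | F, .ex _ A => A.Harrop F
  | _, .restr _ _ => False
  | _, .conc _ => False

def Pred.Harrop : (PVar Sg → Prop) → {ar : List Sg.Srt} → Pred Sg ar → Prop
  | F, _, .var X => F X
  | _, _, .const _ => True
  | F, _, .abs _ A => A.Harrop F
  | F, _, .mu X P => P.Harrop (Function.update F X True)
  | F, _, .nu X P => P.Harrop (Function.update F X True)
end

open Classical in
/-- The predicate variables regarded as predicate constants in the body `P` of a fixed point
`μ (λ X. P)` or `ν (λ X. P)`: those in `F`, where `X` counts iff `P` is `X`-Harrop. -/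
noncomputable def bodyFlags (F : PVar Sg → Prop) (X : PVar Sg) {ar : List Sg.Srt}
    (P : Pred Sg ar) : PVar Sg → Prop :=
  Function.update F X (P.Harrop (Function.update F X True))

open Classical in
mutual
/-- Productivity: every implication and every restriction in the formula is part of a Harrop
formula or of a disjunction. Of the predicate variables outside `F` only those in `b` (the bound
ones) are admitted, since nothing prevents `⊥` from realising a free predicate variable. -/
def Fml.ProductiveAux : (PVar Sg → Prop) → (PVar Sg → Prop) → Fml Sg → Prop
  | _, _, .eq _ _ => True
  | F, b, .app P _ => P.ProductiveAux F b
  | F, b, .and A B => A.ProductiveAux F b ∧ B.ProductiveAux F b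
  | _, _, .or _ _ => True
  | F, _, .imp _ B => B.Harrop F
  | F, b, .all _ A => A.ProductiveAux F b
  | F, b, .ex _ A => A.ProductiveAux F b
  | _, _, .restr _ _ => False
  | F, b, .conc A => A.ProductiveAux F b

def Pred.ProductiveAux : (PVar Sg → Prop) → (PVar Sg → Prop) → {ar : List Sg.Srt} →
    Pred Sg ar → Prop
  | F, b, _, .var X => F X ∨ b X
  | _, _, _, .const _ => True
  | F, b, _, .abs _ A => A.ProductiveAux F b
  | F, b, _, .mu X P => P.ProductiveAux (bodyFlags F X P) (Function.update b X True)
  | F, b, _, .nu X P => P.ProductiveAux (bodyFlags F X P) (Function.update b X True)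
end

/-- Harrop formulas. -/
def Fml.IsHarrop (A : Fml Sg) : Prop := A.Harrop fun _ => False

/-- Productive formulas. -/
def Fml.Productive (A : Fml Sg) : Prop := A.ProductiveAux (fun _ => False) fun _ => False

/-- The formula is productive or a restriction. -/
def Fml.Guarded (F : PVar Sg → Prop) (b : PVar Sg → Prop) : Fml Sg → Prop
  | .restr A _ => A.ProductiveAux F b
  | A => A.ProductiveAux F b

open Classical in
mutual
/-- Types of formulas and predicates; the type variables are the predicate variables. -/
noncomputable def Fml.type : (PVar Sg → Prop) → Fml Sg → Ty (PVar Sg)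
  | _, .eq _ _ => .one
  | F, .app P _ => P.type F
  | F, .and A B =>
    if B.Harrop F then A.type F else if A.Harrop F then B.type F else .prod (A.type F) (B.type F)
  | F, .or A B => .sum (A.type F) (B.type F)
  | F, .imp A B =>
    if B.Harrop F then .one else if A.Harrop F then B.type F else .arrow (A.type F) (B.type F)
  | F, .all _ A => A.type F
  | F, .ex _ A => A.type F
  | F, .restr A _ => A.type F
  | F, .conc A => .amb (A.type F)

noncomputable def Pred.type : (PVar Sg → Prop) → {ar : List Sg.Srt} → Pred Sg ar → Ty (PVar Sg)
  | F, _, .var X => if F X then .one else .var X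
  | _, _, .const _ => .one
  | F, _, .abs _ A => A.type F
  | F, _, .mu X P =>
    if P.Harrop (Function.update F X True) then .one else .fix X (P.type (bodyFlags F X P))
  | F, _, .nu X P =>
    if P.Harrop (Function.update F X True) then .one else .fix X (P.type (bodyFlags F X P))
end

/-! ### Structures and realisability -/

/-- Tuples of elements of the given sorts. -/
def Args {S : Type u} (C : S → Type v) : List S → Type v
  | [] => PUnit
  | s :: ar => C s × Args C ar

/-- A structure for a signature. -/
structure Struc (Sg : Signature.{u}) where
  carrier : Sg.Srt → Type v
  nonempty : ∀ s, Nonempty (carrier s)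
  fn : ∀ f, Args carrier (Sg.dom f) → carrier (Sg.cod f)
  rel : ∀ r, Args carrier (Sg.arity r) → Prop

/-- An assignment of elements to the object variables. -/
abbrev OEnv (S : Struc.{u, v} Sg) : Type (max u v) := ∀ x : OVar Sg, S.carrier x.1

mutual
def Term.eval {S : Struc.{u, v} Sg} (e : OEnv S) : {s : Sg.Srt} → Term Sg s → S.carrier s
  | _, .var x => e x
  | _, .app f ts => S.fn f (ts.eval e)

def Terms.eval {S : Struc.{u, v} Sg} (e : OEnv S) :
    {ar : List Sg.Srt} → Terms Sg ar → Args S.carrier ar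
  | _, .nil => PUnit.unit
  | _, .cons t ts => (t.eval e, ts.eval e)
end

open Classical in
/-- Assigning a tuple of elements to a tuple of object variables. -/
noncomputable def OEnv.bind {S : Struc.{u, v} Sg} :
    OEnv S → (xs : List (OVar Sg)) → Args S.carrier (xs.map Prod.fst) → OEnv S
  | e, [], _ => e
  | e, x :: xs, as => OEnv.bind (Function.update e x as.1) xs as.2

/-- An assignment for the predicate variables. A predicate variable `X` is interpreted by
`prop X` where it is regarded as a predicate constant; otherwise `real X` interprets the
associated predicate variable of the realisability interpretation, which has an extra argument
in `D`, and `ty X` interprets the type variable of `X`. -/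
structure PEnv (S : Struc.{u, v} Sg) where
  prop : ∀ X : PVar Sg, Args S.carrier X.1 → Prop
  real : ∀ X : PVar Sg, Args S.carrier X.1 → D → Prop
  ty : PVar Sg → Set D

open Classical in
noncomputable def PEnv.setProp {S : Struc.{u, v} Sg} (ρ : PEnv S) (X : PVar Sg)
    (Z : Args S.carrier X.1 → Prop) : PEnv S :=
  { ρ with prop := Function.update ρ.prop X Z }

open Classical in
noncomputable def PEnv.setReal {S : Struc.{u, v} Sg} (ρ : PEnv S) (X : PVar Sg)
    (Z : Args S.carrier X.1 → D → Prop) (T : Set D) : PEnv S :=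
  { ρ with real := Function.update ρ.real X Z, ty := Function.update ρ.ty X T }

/-- The realisability interpretation of a formula: the proposition `H`, which is meaningful for
Harrop formulas only, and the set `R` of realisers. -/
structure Meaning where
  H : Prop
  R : D → Prop

open Classical in
/-- `a` realises a Harrop formula iff `a = Nil` and `H` holds. -/
noncomputable def Meaning.ofHarrop (harrop : Prop) (m : Meaning) : Meaning :=
  ⟨m.H, fun a => if harrop then a = D.Nil ∧ m.H else m.R a⟩

open Classical in
mutual
/-- The realisability interpretation of formulas. -/
noncomputable def Fml.sem {S : Struc.{u, v} Sg} :
    (PVar Sg → Prop) → OEnv S → PEnv S → Fml Sg → Meaning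
  | _, e, _, .eq t t' => Meaning.ofHarrop True ⟨t.eval e = t'.eval e, fun _ => False⟩
  | F, e, ρ, .app P ts => Meaning.ofHarrop (P.Harrop F) (P.sem F e ρ (ts.eval e))
  | F, e, ρ, .and A B =>
    let a := A.sem F e ρ
    let b := B.sem F e ρ
    Meaning.ofHarrop (A.Harrop F ∧ B.Harrop F)
      ⟨a.H ∧ b.H, fun c =>
        if B.Harrop F then a.R c ∧ b.H
        else if A.Harrop F then a.H ∧ b.R c
        else ∃ x y, c = D.Pair x y ∧ a.R x ∧ b.R y⟩
  | F, e, ρ, .or A B =>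
    ⟨False, fun c =>
      (∃ x, c = D.Left x ∧ (A.sem F e ρ).R x) ∨ (∃ y, c = D.Right y ∧ (B.sem F e ρ).R y)⟩
  | F, e, ρ, .imp A B =>
    let a := A.sem F e ρ
    let b := B.sem F e ρ
    Meaning.ofHarrop (B.Harrop F)
      ⟨(∃ x, a.R x) → b.H, fun c =>
        if A.Harrop F then c ∈ (B.type F).interp ρ.ty ∧ (a.H → b.R c)
        else c ∈ (Ty.arrow (A.type F) (B.type F)).interp ρ.ty ∧
          ∀ x, a.R x → b.R (D.app c x)⟩
  | F, e, ρ, .all x A =>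
    Meaning.ofHarrop (A.Harrop F)
      ⟨∀ v, (A.sem F (Function.update e x v) ρ).H,
        fun c => ∀ v, (A.sem F (Function.update e x v) ρ).R c⟩
  | F, e, ρ, .ex x A =>
    Meaning.ofHarrop (A.Harrop F)
      ⟨∃ v, (A.sem F (Function.update e x v) ρ).H,
        fun c => ∃ v, (A.sem F (Function.update e x v) ρ).R c⟩
  | F, e, ρ, .restr A B =>
    ⟨False, fun c => c ∈ (A.type F).interp ρ.ty ∧
      ((∃ y, (B.sem F e ρ).R y) → c ≠ ⊥) ∧ (c ≠ ⊥ → (A.sem F e ρ).R c)⟩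
  | F, e, ρ, .conc A =>
    ⟨False, fun c => ∃ x y, c = D.Amb x y ∧
      x ∈ (A.type F).interp ρ.ty ∧ y ∈ (A.type F).interp ρ.ty ∧ (x ≠ ⊥ ∨ y ≠ ⊥) ∧
      (x ≠ ⊥ → (A.sem F e ρ).R x) ∧ (y ≠ ⊥ → (A.sem F e ρ).R y)⟩

/-- The realisability interpretation of predicates. Least and greatest fixed points are the least
pre-fixed and the greatest post-fixed points of the interpretations of the operator. -/
noncomputable def Pred.sem {S : Struc.{u, v} Sg} : (PVar Sg → Prop) → OEnv S → PEnv S →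
    {ar : List Sg.Srt} → Pred Sg ar → Args S.carrier ar → Meaning
  | _, _, ρ, _, .var X, as => ⟨ρ.prop X as, ρ.real X as⟩
  | _, _, _, _, .const r, as => ⟨S.rel r as, fun _ => False⟩
  | F, e, ρ, _, .abs xs A, as => A.sem F (e.bind xs as) ρ
  | F, e, ρ, _, .mu X P, as =>
    ⟨∀ Z : Args S.carrier X.1 → Prop,
        (∀ bs, (P.sem (bodyFlags F X P) e (ρ.setProp X Z) bs).H → Z bs) → Z as,
      fun c => ∀ Z : Args S.carrier X.1 → D → Prop,
        (∀ bs d, (P.sem (bodyFlags F X P) e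
          (ρ.setReal X Z ((Ty.fix X (P.type (bodyFlags F X P))).interp ρ.ty)) bs).R d → Z bs d) →
        Z as c⟩
  | F, e, ρ, _, .nu X P, as =>
    ⟨∃ Z : Args S.carrier X.1 → Prop,
        (∀ bs, Z bs → (P.sem (bodyFlags F X P) e (ρ.setProp X Z) bs).H) ∧ Z as,
      fun c => ∃ Z : Args S.carrier X.1 → D → Prop,
        (∀ bs d, Z bs d → (P.sem (bodyFlags F X P) e
          (ρ.setReal X Z ((Ty.fix X (P.type (bodyFlags F X P))).interp ρ.ty)) bs).R d) ∧
        Z as c⟩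
end

/-- All type variables are interpreted by subdomains. -/
def PEnv.Admissible {S : Struc.{u, v} Sg} (ρ : PEnv S) : Prop := ∀ X, IsSubdomain (ρ.ty X)

/-- The subdomain of potential realisers of a formula. -/
def Fml.typeSet {S : Struc.{u, v} Sg} (ρ : PEnv S) (A : Fml Sg) : Set D :=
  (A.type fun _ => False).interp ρ.ty

/-- `H(A)`, for Harrop formulas `A`. -/
def Fml.HoldsH {S : Struc.{u, v} Sg} (e : OEnv S) (ρ : PEnv S) (A : Fml Sg) : Prop :=
  (A.sem (fun _ => False) e ρ).H

/-- `a : τ(A)` and `a r A`. -/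
def Fml.Realises {S : Struc.{u, v} Sg} (e : OEnv S) (ρ : PEnv S) (A : Fml Sg) (a : D) : Prop :=
  a ∈ A.typeSet ρ ∧ (A.sem (fun _ => False) e ρ).R a

mutual
/-- The formation rules that are not built into the syntax: fixed points are taken of strictly
positive operators only, abstracted variables are distinct, and a formula to which a restriction
or the concurrency modality is applied is productive or is itself a restriction. -/
def Fml.WfAux : (PVar Sg → Prop) → (PVar Sg → Prop) → Fml Sg → Prop
  | _, _, .eq _ _ => True
  | F, b, .app P _ => P.WfAux F b
  | F, b, .and A B => A.WfAux F b ∧ B.WfAux F b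
  | F, b, .or A B => A.WfAux F b ∧ B.WfAux F b
  | F, b, .imp A B => A.WfAux F b ∧ B.WfAux F b
  | F, b, .all _ A => A.WfAux F b
  | F, b, .ex _ A => A.WfAux F b
  | F, b, .restr A B => A.Guarded F b ∧ A.WfAux F b ∧ B.WfAux F b
  | F, b, .conc A => A.Guarded F b ∧ A.WfAux F b

def Pred.WfAux : (PVar Sg → Prop) → (PVar Sg → Prop) → {ar : List Sg.Srt} → Pred Sg ar → Prop
  | _, _, _, .var _ => True
  | _, _, _, .const _ => True
  | F, b, _, .abs xs A => xs.Nodup ∧ A.WfAux F b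
  | F, b, _, .mu X P =>
    P.StrictlyPositive X ∧ P.WfAux (bodyFlags F X P) (open Classical in Function.update b X True)
  | F, b, _, .nu X P =>
    P.StrictlyPositive X ∧ P.WfAux (bodyFlags F X P) (open Classical in Function.update b X True)
end

/-- Well-formed formulas. -/
def Fml.Wf (A : Fml Sg) : Prop := A.WfAux (fun _ => False) fun _ => False

/-! ### Inference rules and their realisers -/

open Classical in
/-- The element `d` has the type of a realiser of the rule with premises `As` and conclusion `C`:
applied to elements of the types of the non-Harrop premises it yields an element of the type of
the conclusion. -/
def TypedRule {S : Struc.{u, v} Sg} (ρ : PEnv S) : List (Fml Sg) → Fml Sg → D → Prop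
  | [], C, d => d ∈ C.typeSet ρ
  | A :: As, C, d =>
    if A.IsHarrop then TypedRule ρ As C d else ∀ a ∈ A.typeSet ρ, TypedRule ρ As C (D.app d a)

open Classical in
/-- The element `d` realises the rule with premises `As` and conclusion `C`: whenever `H(A)` holds
for all Harrop premises `A`, then `d`, applied to realisers of the non-Harrop premises, yields a
realiser of the conclusion. -/
def RealisesRule {S : Struc.{u, v} Sg} (e : OEnv S) (ρ : PEnv S) :
    List (Fml Sg) → Fml Sg → D → Prop
  | [], C, d => C.Realises e ρ d
  | A :: As, C, d =>
    if A.IsHarrop then (A.HoldsH e ρ → RealisesRule e ρ As C d)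
    else ∀ a, A.Realises e ρ a → RealisesRule e ρ As C (D.app d a)

/-- The closed program `M` realises the rule with premises `As` and conclusion `C`, uniformly in
all structures and assignments. -/
def Prog.RealisesRule (M : Prog) (As : List (Fml Sg)) (C : Fml Sg) : Prop :=
  M.Wf ∧ M.ClosedAt 0 ∧
    ∀ (S : Struc.{u, v} Sg) (e : OEnv S) (ρ : PEnv S), ρ.Admissible → ∀ η : ℕ → D,
      TypedRule ρ As C (M.denote η) ∧ CFP.RealisesRule e ρ As C (M.denote η)

/-- The rules for the concurrency modality: `ConcRule As C` means that `C` may be inferred from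
the premises `As`. -/
inductive ConcRule : List (Fml Sg) → Fml Sg → Prop
  | lem (A C : Fml Sg) : A.Wf → C.Wf → A.Productive →
      ConcRule [.restr A C, .restr A C.neg] (.conc A)
  | ret (A : Fml Sg) : A.Wf → A.Productive → ConcRule [A] (.conc A)
  | mon (A B : Fml Sg) : A.Wf → B.Wf → A.Productive → B.Productive →
      ConcRule [.conc A, .imp A B] (.conc B)
  | harrop (A : Fml Sg) : A.Wf → A.IsHarrop → ConcRule [.conc A] A
  | absorb (A B : Fml Sg) : A.Wf → B.Wf → A.Productive →
      ConcRule [.conc (.restr A B)] (.conc A)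
  | disj (A B C E : Fml Sg) : A.Wf → B.Wf → C.Wf → E.Wf → A.Productive → C.Productive →
      ConcRule [.restr A B, .restr C E] (.restr (.conc (.or A C)) (.or B E))
  | intro (A₀ A₁ B : Fml Sg) : A₀.Wf → A₁.Wf → B.Wf →
      A₀.IsHarrop → A₁.IsHarrop → B.IsHarrop →
      ConcRule [.imp B (.conc (.or A₀ A₁)), .imp B.neg (.and A₀ A₁)]
        (.restr (.conc (.or A₀ A₁)) B)

/-! ### Some programs -/

namespace Prog

/-- `λ c. c` -/
def idProg : Prog := lam (var 0)

/-- The patterns `C(_, …, _)` for all constructors `C`, and the function pattern. -/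
def topPats : Fin 6 → Pat :=
  ![.con .nil, .con (.left .var), .con (.right .var), .con (.pair .var .var), .func,
    .con (.amb .var .var)]

/-- Strict application `f↓a`. -/
def strictApp (f a : Prog) : Prog :=
  case a 6 topPats fun i => (app f a).shift (topPats i).arity

/-- `amb_LR(M, N)`, which is `Amb(M, N)` if `M = Left(_)` or `N = Right(_)`. -/
def ambLR (M N : Prog) : Prog :=
  case (pair M N) 2 ![.con (.pair (.left .var) .var), .con (.pair .var (.right .var))]
    fun _ => (amb M N).shift 2

/-- `λ a. λ b. amb_LR(Left↓a, Right↓b)` -/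
def orProg : Prog :=
  lam (lam (ambLR (strictApp (lam (left (var 0))) (var 1))
    (strictApp (lam (right (var 0))) (var 0))))

/-- `λ d. case d of {Left(_) → Left(Nil); Right(_) → Right(Nil)}` -/
def leftRight : Prog :=
  lam (case (var 0) 2 ![.con (.left .var), .con (.right .var)] ![left nil, right nil])

/-- `case M of {Amb(a, b) → Amb(leftRight a, leftRight b)}` -/
def mapLeftRight (M : Prog) : Prog :=
  case M 1 ![.con (.amb .var .var)] ![amb (app leftRight (var 0)) (app leftRight (var 1))]

/-- `λ c. case c of {Amb(C(_), _) → mapLeftRight c; Amb(_, C(_)) → mapLeftRight c |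
C ∈ {Left, Right}}` -/
def introProg : Prog :=
  lam (case (var 0) 4
    ![.con (.amb (.left .var) .var), .con (.amb (.right .var) .var),
      .con (.amb .var (.left .var)), .con (.amb .var (.right .var))]
    fun _ => mapLeftRight (var 2))

end Prog

/-! ### Derivations and soundness -/

/-- A sequent `Γ ⊢ A`. -/
structure Sequent (Sg : Signature.{u}) where
  hyps : List (Fml Sg)
  concl : Fml Sg

/-- `M` is a program extracted from a proof of the sequent: its free variables `η 0, η 1, …` stand
for the assumptions, it has the type of the conclusion if the variables have the types of the
assumptions, and it realises the conclusion if the variables realise the assumptions, in all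
structures of the class `K`. -/
def Prog.RealisesSequent (K : Set (Struc.{u, v} Sg)) (M : Prog) (q : Sequent Sg) : Prop :=
  M.Wf ∧ M.ClosedAt q.hyps.length ∧
    ∀ S ∈ K, ∀ (e : OEnv S) (ρ : PEnv S), ρ.Admissible → ∀ η : ℕ → D,
      ((∀ i (h : i < q.hyps.length), η i ∈ q.hyps[i].typeSet ρ) →
        M.denote η ∈ q.concl.typeSet ρ) ∧
      ((∀ i (h : i < q.hyps.length), q.hyps[i].Realises e ρ (η i)) →
        q.concl.Realises e ρ (M.denote η))

/-- A calculus is given by its rules, which infer a sequent from finitely many sequents. -/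
abbrev Calculus (Sg : Signature.{u}) : Type u := List (Sequent Sg) → Sequent Sg → Prop

inductive Calculus.Derivable (R : Calculus Sg) : Sequent Sg → Prop
  | step (ps : List (Sequent Sg)) (q : Sequent Sg) :
      R ps q → (∀ p ∈ ps, Calculus.Derivable R p) → Calculus.Derivable R q

/-- All rules of the calculus are realisable with respect to the structures in `K`: programs
realising the premises can be turned into a program realising the conclusion. -/
def Calculus.Realisable (K : Set (Struc.{u, v} Sg)) (R : Calculus Sg) : Prop :=
  ∀ ps q, R ps q → (∀ p ∈ ps, ∃ M : Prog, M.RealisesSequent K p) →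
    ∃ M : Prog, M.RealisesSequent K q

/-- The extension of a calculus by the rules for the concurrency modality. -/
def Calculus.withConc (R : Calculus Sg) : Calculus Sg := fun ps q =>
  R ps q ∨ ∃ (Γ : List (Fml Sg)) (As : List (Fml Sg)) (C : Fml Sg),
    ConcRule As C ∧ ps = As.map (fun A => ⟨Γ, A⟩) ∧ q = ⟨Γ, C⟩

end CFP

namespace CFP

/-! ### Continuous operations on the domain -/

-- Each rule is given an explicit program, and two questions arise: which element of `D` it
-- computes, and why that element is well typed and realises the conclusion.
--
-- For the first, abstraction is meaningful only for Scott continuous functions, so the function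
-- behind each program must be shown continuous. The case constructs turn into functions that equal
-- a continuous map on a Scott open guard set and `⊥` elsewhere, hence
-- `ScottOpen.scottContinuous_ite`. Overlapping patterns yield unions of guards. Overlapping clauses
-- are compatible because their bodies are weakenings of one and the same program
-- (`compatible_shift`).
--
-- For the second, definedness decides everything. In `⇊`-lem, classically either `C` or `¬ C` has a
-- realiser, and the corresponding restriction then forces its component to be defined. In
-- absorption, a defined realiser of `A ‖ B` already realises `A`. In the disjunction rule,
-- strictness makes `g a b` defined exactly when `a` or `b` is, and a realiser of `B ∨ E` forces one
-- of them to be. In the introduction rule, `B` makes the given `c` a realiser, so some component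
-- has the shape `Left` or `Right` and `h c` is defined. Conversely, if `h c` is defined, then its
-- tags are correct when `B` holds, while if `B` fails both `A₀` and `A₁` hold and any tag is
-- correct; replacing the arguments by `Nil` makes the result an actual realiser. Return and
-- monotonicity need that `⊥` realises no productive formula (`Fml.Productive.ne_bot`), an induction
-- on formulas in which bound predicate variables may be treated as constants.
--
-- Soundness follows by induction on derivations: the program of a rule is applied to the programs
-- of its non-Harrop premises (`exists_realisesSequent_of_rule`).

/-- Scott open sets of a partial order. -/
def ScottOpen {α : Type*} [Preorder α] (U : Set α) : Prop := IsUpperSet U ∧ DirSupInacc U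

theorem ScottOpen.preimage {α β : Type*} [Preorder α] [Preorder β] {U : Set β} (hU : ScottOpen U)
    {f : α → β} (hf : ScottContinuous f) : ScottOpen (f ⁻¹' U) := by
  refine ⟨fun a b h ha => hU.1 (hf.monotone h) ha, fun S hne hS s hs hsU => ?_⟩
  obtain ⟨_, ⟨d, hd, rfl⟩, hdU⟩ := hU.2 (hne.image f) (hS.mono_comp hf.monotone)
    (hf hne hS hs) hsU
  exact ⟨d, hd, hdU⟩

theorem ScottOpen.union {α : Type*} [Preorder α] {U V : Set α} (hU : ScottOpen U)
    (hV : ScottOpen V) : ScottOpen (U ∪ V) := by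
  refine ⟨hU.1.union hV.1, fun S hne hS s hs hsU => ?_⟩
  rcases hsU with h | h
  · obtain ⟨d, hd, hdU⟩ := hU.2 hne hS hs h
    exact ⟨d, hd, Or.inl hdU⟩
  · obtain ⟨d, hd, hdU⟩ := hV.2 hne hS hs h
    exact ⟨d, hd, Or.inr hdU⟩

/-- Monotonicity gives the upper-bound half of the supremum condition, so only the comparison with
an arbitrary bound `u` of the values is left to check. -/
theorem scottContinuous_of_le {α β : Type*} [Preorder α] [Preorder β] {f : α → β}
    (hm : Monotone f)
    (h : ∀ S : Set α, S.Nonempty → DirectedOn (· ≤ ·) S → ∀ s, IsLUB S s → ∀ u,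
      (∀ d ∈ S, f d ≤ u) → f s ≤ u) : ScottContinuous f := by
  intro S hne hS s hs
  refine ⟨?_, fun u hu => h S hne hS s hs u fun d hd => hu ⟨d, hd, rfl⟩⟩
  rintro _ ⟨d, hd, rfl⟩
  exact hm (hs.1 hd)

theorem ScottContinuous.le_of_forall {α β : Type*} [Preorder α] [Preorder β] {f : α → β}
    (hf : ScottContinuous f) {S : Set α} (hne : S.Nonempty) (hS : DirectedOn (· ≤ ·) S) {s : α}
    (hs : IsLUB S s) {u : β} (h : ∀ d ∈ S, f d ≤ u) : f s ≤ u :=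
  (hf hne hS hs).2 (by rintro _ ⟨d, hd, rfl⟩; exact h d hd)

/-- Openness puts some member of the directed set into `U`. By directedness every member lies below
one that is above it, hence in `U`, where the function is `g`. Outside `U` the value is least, so
nothing is to be shown. -/
theorem ScottOpen.scottContinuous_ite {α : Type*} [Preorder α] {U : Set α}
    {_ : DecidablePred (· ∈ U)} (hU : ScottOpen U) {g : α → D} (hg : ScottContinuous g) :
    ScottContinuous fun d => if d ∈ U then g d else ⊥ := by
  have hm : Monotone fun d => if d ∈ U then g d else ⊥ := by
    intro d e h
    by_cases hd : d ∈ U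
    · simpa [hd, hU.1 h hd] using hg.monotone h
    · simp [hd]
  refine scottContinuous_of_le hm fun S hne hS s hs u hu => ?_
  by_cases hsU : s ∈ U
  · simp only [hsU, if_true]
    obtain ⟨d, hd, hdU⟩ := hU.2 hne hS hs hsU
    refine ScottContinuous.le_of_forall hg hne hS hs fun e he => ?_
    obtain ⟨e', he', h1, h2⟩ := hS d hd e he
    have := hu e' he'
    simp only [hU.1 h1 hdU, if_true] at this
    exact (hg.monotone h2).trans this
  · simp [hsU]

namespace D

-- Constructors of the domain: disjointness, injectivity, order and continuity.

theorem bot_def : (⊥ : D) = fold .bot := rfl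

theorem fold_inj {y z : Layer D Cont} : fold y = fold z ↔ y = z := foldIso.injective.eq_iff

theorem foldIso_symm_fold (y : Layer D Cont) : foldIso.symm (fold y) = y :=
  foldIso.symm_apply_apply y

theorem cases_on {p : D → Prop} (d : D) (bot : p ⊥) (nil : p Nil) (left : ∀ a, p (Left a))
    (right : ∀ a, p (Right a)) (pair : ∀ a b, p (Pair a b)) (func : ∀ f, p (Fun f))
    (amb : ∀ a b, p (Amb a b)) : p d := by
  obtain ⟨y, rfl⟩ := fold_surjective d
  cases y with
  | bot => exact bot
  | nil => exact nil
  | left a => exact left a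
  | right a => exact right a
  | pair a b => exact pair a b
  | func f => exact func f
  | amb a b => exact amb a b

section Injectivity

variable {a a' b b' : D} {f g : Cont}

@[simp] theorem left_inj : Left a = Left a' ↔ a = a' := by simp [Left, fold_inj]
@[simp] theorem right_inj : Right a = Right a' ↔ a = a' := by simp [Right, fold_inj]
@[simp] theorem pair_inj : Pair a b = Pair a' b' ↔ a = a' ∧ b = b' := by simp [Pair, fold_inj]
@[simp] theorem amb_inj : Amb a b = Amb a' b' ↔ a = a' ∧ b = b' := by simp [Amb, fold_inj]
@[simp] theorem fun_inj : Fun f = Fun g ↔ f = g := by simp [Fun, fold_inj]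
@[simp] theorem left_ne_bot : Left a ≠ ⊥ := by simp [Left, bot_def, fold_inj]
@[simp] theorem right_ne_bot : Right a ≠ ⊥ := by simp [Right, bot_def, fold_inj]
@[simp] theorem amb_ne_bot : Amb a b ≠ ⊥ := by simp [Amb, bot_def, fold_inj]
@[simp] theorem fun_ne_bot : Fun f ≠ ⊥ := by simp [Fun, bot_def, fold_inj]
@[simp] theorem bot_ne_nil : ⊥ ≠ Nil := by simp [Nil, bot_def, fold_inj]
@[simp] theorem bot_ne_left : ⊥ ≠ Left a := by simp [Left, bot_def, fold_inj]
@[simp] theorem bot_ne_right : ⊥ ≠ Right a := by simp [Right, bot_def, fold_inj]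
@[simp] theorem bot_ne_amb : ⊥ ≠ Amb a b := by simp [Amb, bot_def, fold_inj]
@[simp] theorem bot_ne_pair : ⊥ ≠ Pair a b := by simp [Pair, bot_def, fold_inj]
@[simp] theorem bot_ne_fun : ⊥ ≠ Fun f := by simp [Fun, bot_def, fold_inj]
@[simp] theorem left_ne_right : Left a ≠ Right b := by simp [Left, Right, fold_inj]
@[simp] theorem right_ne_left : Right a ≠ Left b := by simp [Left, Right, fold_inj]

end Injectivity

theorem left_le {a d : D} : Left a ≤ d ↔ ∃ b, d = Left b ∧ a ≤ b := by
  obtain ⟨y, rfl⟩ := fold_surjective d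
  simp only [Left, fold_le_fold, fold_inj]
  constructor
  · rintro ⟨⟩; exact ⟨_, rfl, by assumption⟩
  · rintro ⟨b, rfl, h⟩; exact .left h

theorem right_le {a d : D} : Right a ≤ d ↔ ∃ b, d = Right b ∧ a ≤ b := by
  obtain ⟨y, rfl⟩ := fold_surjective d
  simp only [Right, fold_le_fold, fold_inj]
  constructor
  · rintro ⟨⟩; exact ⟨_, rfl, by assumption⟩
  · rintro ⟨b, rfl, h⟩; exact .right h

theorem amb_le {a a' d : D} : Amb a a' ≤ d ↔ ∃ b b', d = Amb b b' ∧ a ≤ b ∧ a' ≤ b' := by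
  obtain ⟨y, rfl⟩ := fold_surjective d
  simp only [Amb, fold_le_fold, fold_inj]
  constructor
  · rintro ⟨⟩; exact ⟨_, _, rfl, by assumption, by assumption⟩
  · rintro ⟨b, b', rfl, h, h'⟩; exact .amb h h'

theorem fun_le {f : Cont} {d : D} : Fun f ≤ d ↔ ∃ g : Cont, d = Fun g ∧ ∀ a, f.1 a ≤ g.1 a := by
  obtain ⟨y, rfl⟩ := fold_surjective d
  simp only [Fun, fold_le_fold, fold_inj]
  constructor
  · rintro ⟨⟩; exact ⟨_, rfl, by assumption⟩
  · rintro ⟨b, rfl, h⟩; exact .func h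

theorem amb_mono {a a' b b' : D} (h : a ≤ b) (h' : a' ≤ b') : Amb a a' ≤ Amb b b' :=
  amb_le.2 ⟨_, _, rfl, h, h'⟩

/-- Only an `Amb` lies above an `Amb`. As the directed set is nonempty, every bound of the values is
therefore itself an `Amb`, and the suprema can be compared componentwise. -/
theorem scottContinuous_amb {α : Type*} [Preorder α] {f g : α → D} (hf : ScottContinuous f)
    (hg : ScottContinuous g) : ScottContinuous fun d => Amb (f d) (g d) := by
  refine scottContinuous_of_le (fun _ _ h => amb_mono (hf.monotone h) (hg.monotone h)) ?_
  intro S hne hS s hs u hu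
  obtain ⟨d, hd⟩ := hne
  obtain ⟨b, b', rfl, -, -⟩ := amb_le.1 (hu d hd)
  have h : ∀ e ∈ S, f e ≤ b ∧ g e ≤ b' := fun e he => by
    obtain ⟨c, c', h1, h2, h3⟩ := amb_le.1 (hu e he)
    rw [amb_inj] at h1
    rw [h1.1, h1.2]; exact ⟨h2, h3⟩
  exact amb_mono (ScottContinuous.le_of_forall hf ⟨d, hd⟩ hS hs fun e he => (h e he).1)
    (ScottContinuous.le_of_forall hg ⟨d, hd⟩ hS hs fun e he => (h e he).2)

theorem scottContinuous_left : ScottContinuous Left := by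
  refine scottContinuous_of_le (fun _ _ h => left_le.2 ⟨_, rfl, h⟩) ?_
  intro S hne hS s hs u hu
  obtain ⟨d, hd⟩ := hne
  obtain ⟨b, rfl, -⟩ := left_le.1 (hu d hd)
  refine left_le.2 ⟨b, rfl, hs.2 fun e he => ?_⟩
  simpa using left_le.1 (hu e he)

theorem scottContinuous_right : ScottContinuous Right := by
  refine scottContinuous_of_le (fun _ _ h => right_le.2 ⟨_, rfl, h⟩) ?_
  intro S hne hS s hs u hu
  obtain ⟨d, hd⟩ := hne
  obtain ⟨b, rfl, -⟩ := right_le.1 (hu d hd)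
  refine right_le.2 ⟨b, rfl, hs.2 fun e he => ?_⟩
  simpa using right_le.1 (hu e he)

-- Application and abstraction.

@[simp] theorem app_fun (f : Cont) (a : D) : app (Fun f) a = f.1 a := by
  simp [app, Fun, foldIso_symm_fold]

theorem app_eq_bot {d : D} (h : ∀ f, d ≠ Fun f) (a : D) : app d a = ⊥ := by
  obtain ⟨y, rfl⟩ := fold_surjective d
  rw [app, foldIso_symm_fold]
  cases y with
  | func f => exact absurd rfl (h f)
  | _ => rfl

@[simp] theorem app_bot (a : D) : app ⊥ a = ⊥ := app_eq_bot (fun _ => Ne.symm fun_ne_bot) a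

theorem app_abs {f : D → D} (hf : ScottContinuous f) (a : D) : app (abs f) a = f a := by
  rw [abs, dif_pos hf, app_fun]

theorem app_mono_left {d e : D} (h : d ≤ e) (a : D) : app d a ≤ app e a := by
  by_cases hd : ∃ f, d = Fun f
  · obtain ⟨f, rfl⟩ := hd
    obtain ⟨g, rfl, hg⟩ := fun_le.1 h
    simpa using hg a
  · rw [app_eq_bot fun f hf => hd ⟨f, hf⟩]
    exact bot_le

theorem scottContinuous_app_right (d : D) : ScottContinuous (app d) := by
  by_cases hd : ∃ f, d = Fun f
  · obtain ⟨f, rfl⟩ := hd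
    have : app (Fun f) = f.1 := funext fun a => app_fun f a
    rw [this]; exact f.2
  · have : app d = Function.const D ⊥ := funext fun a => app_eq_bot (fun f hf => hd ⟨f, hf⟩) a
    rw [this]; exact ScottContinuous.const _

/-- Every level of the value of a continuous function is determined by an approximation of the
argument. -/
theorem Cont.exists_val_eq (f : Cont) (a : D) (n : ℕ) :
    ∃ m, n ≤ m ∧ (f.1 (emb m (a.val m))).val n = (f.1 a).val n := by
  have hmono : Monotone fun n => emb n (a.val n) := by
    intro i j h k
    change tr i k (a.val i) ≤ tr j k (a.val j)
    rw [← a.compat i j h]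
    exact tr_tr_le j i k _
  have hlub : IsLUB (Set.range fun n => emb n (a.val n)) a := by
    refine ⟨?_, fun u hu n => ?_⟩
    · rintro _ ⟨n, rfl⟩; exact emb_val_le n a
    · have := hu ⟨n, rfl⟩ n
      rwa [emb_val_self] at this
  have hdir := directedOn_range.2 hmono.directed_le
  obtain ⟨_, ⟨_, ⟨m, rfl⟩, rfl⟩, hm⟩ := attained ((Set.range_nonempty _).image f.1)
    (hdir.mono_comp f.2.monotone) (f.2 (Set.range_nonempty _) hdir hlub) n
  -- Raising the level to at least `n` is harmless: the value stays between the one at level `m` and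
  -- `f a`, which agree at level `n`.
  refine ⟨max n m, le_max_left _ _, le_antisymm (f.2.monotone (emb_val_le _ a) n) ?_⟩
  rw [← hm]
  exact f.2.monotone (hmono (le_max_right n m)) n

/-- Suprema in `D` are controlled level by level. Level `n` of `g a` depends only on `g` at some
finite approximation of `a`, say of level `m`, hence on `g.approx m`. This is a part of level `m +
1` of `Fun g`, and each level of a directed supremum is attained by a member of the set. -/
theorem scottContinuous_app_left (a : D) : ScottContinuous fun d => app d a := by
  refine scottContinuous_of_le (fun _ _ h => app_mono_left h a) ?_
  intro S hne hS s hs u hu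
  by_cases hd : ∃ f, s = Fun f
  · obtain ⟨g, rfl⟩ := hd
    simp only [app_fun]
    intro n
    obtain ⟨m, hnm, hm⟩ := Cont.exists_val_eq g a n
    obtain ⟨d, hdS, hd⟩ := attained hne hS hs (m + 1)
    have hf : ∃ f : Cont, d = Fun f ∧ f.approx m = g.approx m := by
      obtain ⟨y, rfl⟩ := fold_surjective d
      have hd' : Layer.map (fun d : D => d.val m) (fun f : Cont => f.approx m) y
        = .func (g.approx m) := hd
      cases y <;> simp only [Layer.map, reduceCtorEq, Layer.func.injEq] at hd'
      exact ⟨_, rfl, hd'⟩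
    obtain ⟨f, rfl, hfg⟩ := hf
    have h1 : (g.1 (emb m (a.val m))).val m ≤ u.val m := by
      have h2 : (f.1 (emb m (a.val m))).val m = (g.1 (emb m (a.val m))).val m :=
        congrArg (fun h : T m →o T m => h (a.val m)) hfg
      rw [← h2]
      have h3 := hu _ hdS
      rw [app_fun] at h3
      exact (f.2.monotone (emb_val_le m a) m).trans (h3 m)
    rw [← hm, ← D.compat _ n m hnm, ← D.compat u n m hnm]
    exact (tr m n).monotone h1
  · rw [app_eq_bot fun f hf => hd ⟨f, hf⟩]
    exact bot_le

/-- Separate continuity is enough: a bound of the abstractions is itself some `Fun g`, and the order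
on functions is pointwise, so each argument can be fixed and treated alone. -/
theorem scottContinuous_abs {α : Type*} [Preorder α] {F : α → D → D}
    (h1 : ∀ a, ScottContinuous (F a)) (h2 : ∀ d, ScottContinuous fun a => F a d) :
    ScottContinuous fun a => abs (F a) := by
  have e : ∀ a, abs (F a) = Fun ⟨F a, h1 a⟩ := fun a => dif_pos (h1 a)
  simp only [e]
  refine scottContinuous_of_le (fun _ _ h => fun_le.2 ⟨_, rfl, fun d => (h2 d).monotone h⟩) ?_
  intro S hne hS s hs u hu
  have ⟨d, hd⟩ := hne
  obtain ⟨g, rfl, -⟩ := fun_le.1 (hu d hd)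
  refine fun_le.2 ⟨g, rfl, fun x => ScottContinuous.le_of_forall (h2 x) hne hS hs fun e he => ?_⟩
  obtain ⟨g', hg, h⟩ := fun_le.1 (hu e he)
  rw [fun_inj] at hg
  rw [hg]; exact h x

-- Open sets given by the outermost constructor, and the components of `Amb`.

theorem scottOpen_ne_bot : ScottOpen {d : D | d ≠ ⊥} := by
  refine ⟨fun a b h ha hb => ha (by subst hb; exact le_bot_iff.1 h), ?_⟩
  intro S hne hS s hs hsU
  by_contra hc
  refine hsU (le_bot_iff.1 (hs.2 fun d hd => ?_))
  by_contra hd'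
  exact hc ⟨d, hd, fun h => hd' h.le⟩

/-- A set of elements other than `⊥` is open if it is closed under comparability. -/
theorem scottOpen_of_comparable {U : Set D} (h0 : ∀ d ∈ U, d ≠ ⊥)
    (h : ∀ d e, d ≤ e → d ≠ ⊥ → (d ∈ U ↔ e ∈ U)) : ScottOpen U := by
  refine ⟨fun d e hde hd => (h d e hde (h0 d hd)).1 hd, fun S hne hS s hs hsU => ?_⟩
  obtain ⟨d, hd, hd0⟩ := scottOpen_ne_bot.2 hne hS hs (h0 s hsU)
  exact ⟨d, hd, (h d s (hs.1 hd) hd0).2 hsU⟩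

theorem scottOpen_left : ScottOpen {d : D | ∃ a, d = Left a} := by
  refine scottOpen_of_comparable (by rintro _ ⟨a, rfl⟩; simp) fun d e h hd => ?_
  obtain ⟨y, rfl⟩ := fold_surjective d
  obtain ⟨z, rfl⟩ := fold_surjective e
  rw [fold_le_fold] at h
  rw [Ne, bot_def, fold_inj] at hd
  cases h <;> simp_all [Left, fold_inj]

theorem scottOpen_right : ScottOpen {d : D | ∃ a, d = Right a} := by
  refine scottOpen_of_comparable (by rintro _ ⟨a, rfl⟩; simp) fun d e h hd => ?_
  obtain ⟨y, rfl⟩ := fold_surjective d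
  obtain ⟨z, rfl⟩ := fold_surjective e
  rw [fold_le_fold] at h
  rw [Ne, bot_def, fold_inj] at hd
  cases h <;> simp_all [Right, fold_inj]

theorem scottOpen_amb : ScottOpen {d : D | ∃ a b, d = Amb a b} := by
  refine scottOpen_of_comparable (by rintro _ ⟨a, b, rfl⟩; simp) fun d e h hd => ?_
  obtain ⟨y, rfl⟩ := fold_surjective d
  obtain ⟨z, rfl⟩ := fold_surjective e
  rw [fold_le_fold] at h
  rw [Ne, bot_def, fold_inj] at hd
  cases h <;> simp_all [Amb, fold_inj]

/-- The components of `Amb a b`. -/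
noncomputable def ambParts (d : D) : D × D :=
  match foldIso.symm d with
  | .amb a b => (a, b)
  | _ => ⊥

@[simp] theorem ambParts_amb (a b : D) : ambParts (Amb a b) = (a, b) := by
  simp [ambParts, Amb, foldIso_symm_fold]

theorem ambParts_eq_bot {d : D} (h : ∀ a b, d ≠ Amb a b) : ambParts d = ⊥ := by
  obtain ⟨y, rfl⟩ := fold_surjective d
  rw [ambParts, foldIso_symm_fold]
  cases y with
  | amb a b => exact absurd rfl (h a b)
  | _ => rfl

/-- If `u` bounds the component pairs of a directed set with supremum `Amb a b`, then `Amb u.1 u.2`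
bounds the set itself, since everything below an `Amb` is `⊥` or an `Amb`. It thus bounds the
supremum, and its components can be read off. -/
theorem scottContinuous_ambParts : ScottContinuous ambParts := by
  have key : ∀ d : D, (∃ a b, d = Amb a b) ∨ ambParts d = ⊥ := fun d => by
    by_cases h : ∃ a b, d = Amb a b
    · exact .inl h
    · exact .inr (ambParts_eq_bot fun a b e => h ⟨a, b, e⟩)
  refine scottContinuous_of_le (fun d e h => ?_) fun S hne hS s hs u hu => ?_
  · rcases key d with ⟨a, b, rfl⟩ | hd
    · obtain ⟨a', b', rfl, h1, h2⟩ := amb_le.1 h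
      simpa using ⟨h1, h2⟩
    · rw [hd]; exact bot_le
  · rcases key s with ⟨a, b, rfl⟩ | hs'
    · have hle : Amb a b ≤ Amb u.1 u.2 := by
        refine hs.2 fun d hd => ?_
        rcases key d with ⟨a', b', rfl⟩ | hd'
        · have := hu _ hd
          rw [ambParts_amb] at this
          exact amb_mono this.1 this.2
        · obtain ⟨y, rfl⟩ := fold_surjective d
          have h := hs.1 hd
          rw [Amb, fold_le_fold] at h
          cases h with
          | bot => exact bot_le
          | amb h1 h2 =>
            have := hu _ hd
            change ambParts (Amb _ _) ≤ u at this
            rw [ambParts_amb] at this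
            exact amb_mono this.1 this.2
      obtain ⟨_, _, h, h1, h2⟩ := amb_le.1 hle
      rw [amb_inj] at h
      rw [ambParts_amb]
      exact ⟨h.1 ▸ h1, h.2 ▸ h2⟩
    · rw [hs']; exact bot_le

end D

/-! ### Renaming, substitution and well-formedness -/

namespace Prog

/-- The denotation takes a matching clause by choice, so a value can be asserted only if all
matching clauses yield it. -/
theorem denote_case_of_matches {M : Prog} {n : ℕ} {P : Fin n → Pat} {N : Fin n → Prog} {η : ℕ → D}
    {v : D} {i : Fin n} {l : List D} (hi : (P i).Matches (M.denote η) l)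
    (h : ∀ i l, (P i).Matches (M.denote η) l → (N i).denote (extend l η) = v) :
    (case M n P N).denote η = v := by
  have hc : ∃ c : Fin n × List D, (P c.1).Matches (M.denote η) c.2 := ⟨(i, l), hi⟩
  rw [denote, dif_pos hc]
  exact h _ _ hc.choose_spec

theorem denote_case_of_not_matches {M : Prog} {n : ℕ} {P : Fin n → Pat} {N : Fin n → Prog}
    {η : ℕ → D} (h : ∀ i l, ¬ (P i).Matches (M.denote η) l) : (case M n P N).denote η = ⊥ := by
  rw [denote, dif_neg]
  rintro ⟨c, hc⟩
  exact h _ _ hc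

end Prog

theorem CPat.Matches.length_eq {p : CPat} {d : D} {l : List D} (h : p.Matches d l) :
    l.length = p.arity := by
  induction p generalizing d l with
  | var => simp [CPat.Matches] at h; simp [h, CPat.arity]
  | nil => simp [CPat.Matches] at h; simp [h, CPat.arity]
  | left p ih => obtain ⟨a, -, h⟩ := h; exact ih h
  | right p ih => obtain ⟨a, -, h⟩ := h; exact ih h
  | pair p q ihp ihq =>
    obtain ⟨a, b, la, lb, -, ha, hb, rfl⟩ := h
    simp [CPat.arity, ihp ha, ihq hb]
  | amb p q ihp ihq =>
    obtain ⟨a, b, la, lb, -, ha, hb, rfl⟩ := h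
    simp [CPat.arity, ihp ha, ihq hb]

theorem Pat.Matches.length_eq {p : Pat} {d : D} {l : List D} (h : p.Matches d l) :
    l.length = p.arity := by
  cases p with
  | con p => exact CPat.Matches.length_eq h
  | func => simp [h.2, Pat.arity]

theorem CPat.length_of_progMatch {p : CPat} {M : Prog} {θ : List Prog}
    (h : p.progMatch M = some θ) : θ.length = p.arity := by
  induction p generalizing M θ with
  | var => simp [CPat.progMatch] at h; simp [← h, CPat.arity]
  | nil => cases M <;> simp [CPat.progMatch] at h; simp [← h, CPat.arity]
  | left p ih => cases M <;> simp [CPat.progMatch] at h; exact ih h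
  | right p ih => cases M <;> simp [CPat.progMatch] at h; exact ih h
  | pair p q ihp ihq =>
    cases M <;> simp [CPat.progMatch, Option.bind_eq_some_iff] at h
    obtain ⟨θ₁, h1, θ₂, h2, rfl⟩ := h
    simp [CPat.arity, ihp h1, ihq h2]
  | amb p q ihp ihq =>
    cases M <;> simp [CPat.progMatch, Option.bind_eq_some_iff] at h
    obtain ⟨θ₁, h1, θ₂, h2, rfl⟩ := h
    simp [CPat.arity, ihp h1, ihq h2]

theorem Pat.length_of_progMatch {p : Pat} {M : Prog} {θ : List Prog}
    (h : p.progMatch M = some θ) : θ.length = p.arity := by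
  cases p with
  | con p => exact CPat.length_of_progMatch h
  | func => cases M <;> simp [Pat.progMatch] at h; simp [← h, Pat.arity]

theorem extend_liftRen (l : List D) (η : ℕ → D) (f : ℕ → ℕ) :
    extend l η ∘ Prog.liftRen l.length f = extend l (η ∘ f) := by
  funext i
  by_cases h : i < l.length <;> simp [extend, Prog.liftRen, h]

namespace Prog

theorem denote_rename (M : Prog) (f : ℕ → ℕ) (η : ℕ → D) :
    (M.rename f).denote η = M.denote (η ∘ f) := by
  induction M generalizing f η with
  | var i => rfl
  | nil => rfl
  | left M ih => simp [rename, denote, ih]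
  | right M ih => simp [rename, denote, ih]
  | pair M N ihM ihN => simp [rename, denote, ihM, ihN]
  | amb M N ihM ihN => simp [rename, denote, ihM, ihN]
  | app M N ihM ihN => simp [rename, denote, ihM, ihN]
  | fix M ih => simp [rename, denote, ih]
  | bot => rfl
  | lam M ih =>
    simp only [rename, denote, ih]
    congr 1; funext d
    rw [← extend_liftRen]; rfl
  | case M n P N ihM ihN =>
    rw [rename, denote, denote, ihM]
    simp only [ihN]
    -- Renaming leaves the patterns and the value of the scrutinee unchanged, so both sides choose
    -- the same clause and the same environment.
    split_ifs with h
    · rw [← extend_liftRen, Pat.Matches.length_eq h.choose_spec]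
    · rfl

theorem denote_shift (M : Prog) (η : ℕ → D) {l : List D} {k : ℕ} (h : l.length = k) :
    (M.shift k).denote (extend l η) = M.denote η := by
  rw [shift, denote_rename]
  congr 1; funext i
  simp [extend, h]

theorem subst_rename (M : Prog) (f : ℕ → ℕ) (σ : ℕ → Prog) :
    (M.rename f).subst σ = M.subst (σ ∘ f) := by
  have key : ∀ k (f : ℕ → ℕ) (σ : ℕ → Prog), liftSub k σ ∘ liftRen k f = liftSub k (σ ∘ f) := by
    intro k f σ
    funext i
    by_cases h : i < k <;> simp [liftSub, liftRen, h]
  induction M generalizing f σ with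
  | var i => rfl
  | nil => rfl
  | left M ih => simp [rename, subst, ih]
  | right M ih => simp [rename, subst, ih]
  | pair M N ihM ihN => simp [rename, subst, ihM, ihN]
  | amb M N ihM ihN => simp [rename, subst, ihM, ihN]
  | app M N ihM ihN => simp [rename, subst, ihM, ihN]
  | fix M ih => simp [rename, subst, ih]
  | bot => rfl
  | lam M ih => simp [rename, subst, ih, key]
  | case M n P N ihM ihN => simp [rename, subst, ihM, ihN, key]

theorem subst_var (M : Prog) : M.subst var = M := by
  have key : ∀ k, liftSub k var = var := by
    intro k
    funext i
    by_cases h : i < k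
    · simp [liftSub, h]
    · simp [liftSub, h, shift, rename, Nat.sub_add_cancel (not_lt.1 h)]
  induction M with
  | var i => rfl
  | nil => rfl
  | left M ih => simp [subst, ih]
  | right M ih => simp [subst, ih]
  | pair M N ihM ihN => simp [subst, ihM, ihN]
  | amb M N ihM ihN => simp [subst, ihM, ihN]
  | app M N ihM ihN => simp [subst, ihM, ihN]
  | fix M ih => simp [subst, ih]
  | bot => rfl
  | lam M ih => simp [subst, ih, key]
  | case M n P N ihM ihN => simp [subst, ihM, ihN, key]

/-- A weakened program does not mention the variables being instantiated, so the substitution merely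
undoes the weakening. -/
theorem inst_shift (M : Prog) (θ : List Prog) : (M.shift θ.length).inst θ = M := by
  rw [shift, inst, subst_rename]
  refine Eq.trans (congrArg (M.subst ·) ?_) M.subst_var
  funext i
  simp

theorem ClosedAt.mono {M : Prog} {k n : ℕ} (h : M.ClosedAt k) (hkn : k ≤ n) : M.ClosedAt n := by
  induction M generalizing k n with
  | var i => exact lt_of_lt_of_le h hkn
  | nil => trivial
  | left M ih => exact ih h hkn
  | right M ih => exact ih h hkn
  | pair M N ihM ihN => exact ⟨ihM h.1 hkn, ihN h.2 hkn⟩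
  | amb M N ihM ihN => exact ⟨ihM h.1 hkn, ihN h.2 hkn⟩
  | app M N ihM ihN => exact ⟨ihM h.1 hkn, ihN h.2 hkn⟩
  | fix M ih => exact ih h hkn
  | bot => trivial
  | lam M ih => exact ih h (by omega)
  | case M n P N ihM ihN => exact ⟨ihM h.1 hkn, fun i => ihN i (h.2 i) (by omega)⟩

theorem ClosedAt.rename {M : Prog} {k n : ℕ} {f : ℕ → ℕ} (h : M.ClosedAt k)
    (hf : ∀ i < k, f i < n) : (M.rename f).ClosedAt n := by
  have key : ∀ {k n j : ℕ} {f : ℕ → ℕ}, (∀ i < k, f i < n) → ∀ i < k + j, liftRen j f i < n + j := by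
    intro k n j f hf i hi
    by_cases h : i < j
    · simp [liftRen, h]; omega
    · have := hf (i - j) (by omega)
      simp [liftRen, h]; omega
  induction M generalizing k n f with
  | var i => exact hf i h
  | nil => trivial
  | left M ih => exact ih h hf
  | right M ih => exact ih h hf
  | pair M N ihM ihN => exact ⟨ihM h.1 hf, ihN h.2 hf⟩
  | amb M N ihM ihN => exact ⟨ihM h.1 hf, ihN h.2 hf⟩
  | app M N ihM ihN => exact ⟨ihM h.1 hf, ihN h.2 hf⟩
  | fix M ih => exact ih h hf
  | bot => trivial
  | lam M ih => exact ih h (key hf)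
  | case M n P N ihM ihN => exact ⟨ihM h.1 hf, fun i => ihN i (h.2 i) (key hf)⟩

theorem ClosedAt.shift {M : Prog} {k : ℕ} (n : ℕ) (h : M.ClosedAt k) :
    (M.shift n).ClosedAt (k + n) := h.rename fun i hi => by omega

end Prog

-- Compatibility of clauses, and strict application.

theorem compatible_self (P : Pat) (N : Prog) : Compatible P N P N := by
  intro M θ₁ θ₂ h1 h2
  rw [h1] at h2
  rw [Option.some.inj h2]

/-- A matching substitution is as long as the arity of its pattern, so both bodies instantiate to
`N`. This legitimises the overlapping patterns of `ambLR` and `introProg`. -/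
theorem compatible_shift (P₁ P₂ : Pat) (N : Prog) :
    Compatible P₁ (N.shift P₁.arity) P₂ (N.shift P₂.arity) := by
  intro M θ₁ θ₂ h1 h2
  rw [← Pat.length_of_progMatch h1, ← Pat.length_of_progMatch h2, Prog.inst_shift, Prog.inst_shift]

/-- Patterns without common instances. -/
theorem compatible_of_disjoint {P₁ P₂ : Pat}
    (h : ∀ M θ₁ θ₂, P₁.progMatch M = some θ₁ → P₂.progMatch M ≠ some θ₂) (N₁ N₂ : Prog) :
    Compatible P₁ N₁ P₂ N₂ := fun M θ₁ θ₂ h1 h2 => absurd h2 (h M θ₁ θ₂ h1)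

namespace Prog

theorem rename_rename (M : Prog) (f g : ℕ → ℕ) : (M.rename f).rename g = M.rename (g ∘ f) := by
  have key : ∀ k (f g : ℕ → ℕ), liftRen k g ∘ liftRen k f = liftRen k (g ∘ f) := by
    intro k f g
    funext i
    by_cases h : i < k <;> simp [liftRen, h]
  induction M generalizing f g with
  | var i => rfl
  | nil => rfl
  | left M ih => simp [rename, ih]
  | right M ih => simp [rename, ih]
  | pair M N ihM ihN => simp [rename, ihM, ihN]
  | amb M N ihM ihN => simp [rename, ihM, ihN]
  | app M N ihM ihN => simp [rename, ihM, ihN]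
  | fix M ih => simp [rename, ih]
  | bot => rfl
  | lam M ih => simp [rename, ih, key]
  | case M n P N ihM ihN => simp [rename, ihM, ihN, key]

theorem rename_shift (M : Prog) (k : ℕ) (f : ℕ → ℕ) :
    (M.shift k).rename (liftRen k f) = (M.rename f).shift k := by
  rw [shift, shift, rename_rename, rename_rename]
  congr 1; funext i
  simp [liftRen]

theorem rename_strictApp (f a : Prog) (r : ℕ → ℕ) :
    (strictApp f a).rename r = strictApp (f.rename r) (a.rename r) := by
  simp only [strictApp, rename, rename_shift]

/-- All renamings of the program are well-formed. -/
def StablyWf (M : Prog) : Prop := ∀ f, (M.rename f).Wf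

theorem StablyWf.wf {M : Prog} (h : M.StablyWf) : M.Wf := by
  have e : M.rename id = M :=
    (subst_var _).symm.trans ((subst_rename M id var).trans (subst_var M))
  have := h id
  rwa [e] at this

/-- The clause bodies are weakened copies of `app f a`, so well-formedness of `f` and `a` is needed
along renamings too; carrying the stable form as a hypothesis avoids transporting compatibility
along a renaming. -/
theorem stablyWf_strictApp {f a : Prog} (hf : f.StablyWf) (ha : a.StablyWf) :
    (strictApp f a).StablyWf := by
  intro r
  rw [rename_strictApp]
  refine ⟨ha r, fun _ => ?_, fun _ _ => compatible_shift _ _ _⟩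
  change ((f.rename r).rename _).Wf ∧ ((a.rename r).rename _).Wf
  rw [rename_rename, rename_rename]
  exact ⟨hf _, ha _⟩

theorem closedAt_strictApp {f a : Prog} {k : ℕ} (hf : f.ClosedAt k) (ha : a.ClosedAt k) :
    (strictApp f a).ClosedAt k := ⟨ha, fun _ => ClosedAt.shift (M := app f a) _ ⟨hf, ha⟩⟩

theorem denote_strictApp_of_eq_bot {f a : Prog} {η : ℕ → D} (h : a.denote η = ⊥) :
    (strictApp f a).denote η = ⊥ := by
  refine denote_case_of_not_matches fun i l hl => ?_
  rw [h] at hl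
  fin_cases i <;> simp [topPats, Pat.Matches, CPat.Matches, -Subtype.exists] at hl

/-- The six patterns cover all constructors, so every element other than `⊥` matches one, and all
bodies are the same weakened application. -/
theorem denote_strictApp_of_ne_bot {f a : Prog} {η : ℕ → D} (h : a.denote η ≠ ⊥) :
    (strictApp f a).denote η = D.app (f.denote η) (a.denote η) := by
  have hm : ∃ i l, (topPats i).Matches (a.denote η) l := by
    generalize a.denote η = d at h
    induction d using D.cases_on with
    | bot => exact absurd rfl h
    | nil => exact ⟨0, [], rfl, rfl⟩
    | left a => exact ⟨1, [a], a, rfl, rfl⟩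
    | right a => exact ⟨2, [a], a, rfl, rfl⟩
    | pair a b => exact ⟨3, [a, b], a, b, [a], [b], rfl, rfl, rfl, rfl⟩
    | func f => exact ⟨4, [D.Fun f], ⟨f, rfl⟩, rfl⟩
    | amb a b => exact ⟨5, [a, b], a, b, [a], [b], rfl, rfl, rfl, rfl⟩
  obtain ⟨i, l, hi⟩ := hm
  exact denote_case_of_matches hi fun j l hj => denote_shift _ _ (Pat.Matches.length_eq hj)

end Prog

/-! ### Denotations of the realising programs -/

namespace D

open Classical in
/-- Strict application. -/
noncomputable def strictApp (f a : D) : D := if a ∈ {d : D | d ≠ ⊥} then app f a else ⊥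

theorem scottContinuous_strictApp_right (f : D) : ScottContinuous (strictApp f) :=
  scottOpen_ne_bot.scottContinuous_ite (scottContinuous_app_right f)

theorem scottContinuous_strictApp_left (a : D) : ScottContinuous fun f => strictApp f a := by
  by_cases h : a = ⊥
  · simp [strictApp, h]
  · simpa [strictApp, h] using scottContinuous_app_left a

@[simp] theorem strictApp_bot (f : D) : strictApp f ⊥ = ⊥ := by simp [strictApp]

theorem strictApp_of_ne_bot (f : D) {a : D} (h : a ≠ ⊥) : strictApp f a = app f a := by
  simp [strictApp, h]

open Classical in
/-- `Amb(a, b)` if `a = Left(_)` or `b = Right(_)`. -/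
noncomputable def ambLR (p : D × D) : D :=
  if p ∈ Prod.fst ⁻¹' {d : D | ∃ a, d = Left a} ∪ Prod.snd ⁻¹' {d : D | ∃ b, d = Right b} then
    Amb p.1 p.2 else ⊥

/-- Each of the two overlapping patterns contributes an open condition on one coordinate; their
union is the guard, on which the value is uniformly `Amb`. -/
theorem scottContinuous_ambLR : ScottContinuous ambLR :=
  ((scottOpen_left.preimage ScottContinuous.fst).union
    (scottOpen_right.preimage ScottContinuous.snd)).scottContinuous_ite
      (scottContinuous_amb ScottContinuous.fst ScottContinuous.snd)

open Classical in
/-- `Left(_) ↦ Left(Nil)`, `Right(_) ↦ Right(Nil)`. -/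
noncomputable def leftRight (d : D) : D :=
  if ∃ a, d = Left a then Left Nil else if ∃ a, d = Right a then Right Nil else ⊥

@[simp] theorem leftRight_left (a : D) : leftRight (Left a) = Left Nil := by simp [leftRight]

@[simp] theorem leftRight_right (a : D) : leftRight (Right a) = Right Nil := by simp [leftRight]

theorem leftRight_eq_bot {d : D} (hl : ∀ a, d ≠ Left a) (hr : ∀ a, d ≠ Right a) :
    leftRight d = ⊥ := by simp [leftRight, hl, hr]

@[simp] theorem leftRight_bot : leftRight ⊥ = ⊥ := by simp [leftRight]

/-- The value depends only on the outermost constructor, which no longer changes above an element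
other than `⊥`. Continuity then amounts to finding one defined member of a directed set. -/
theorem leftRight_eq_of_le {d e : D} (h : d ≤ e) (hd : d ≠ ⊥) : leftRight d = leftRight e := by
  obtain ⟨y, rfl⟩ := fold_surjective d
  obtain ⟨z, rfl⟩ := fold_surjective e
  rw [fold_le_fold] at h
  rw [Ne, bot_def, fold_inj] at hd
  cases h <;> simp_all [leftRight, Left, Right, fold_inj]

theorem scottContinuous_leftRight : ScottContinuous leftRight := by
  refine scottContinuous_of_le (fun d e h => ?_) fun S hne hS s hs u hu => ?_
  · by_cases hd : d = ⊥
    · simp [hd]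
    · exact (leftRight_eq_of_le h hd).le
  · by_cases h : s = ⊥
    · simp [h]
    · obtain ⟨d, hd, hd0⟩ := scottOpen_ne_bot.2 hne hS hs h
      rw [← leftRight_eq_of_le (hs.1 hd) hd0]
      exact hu d hd

/-- The elements of the form `Left(_)` or `Right(_)`. -/
def leftOrRight : Set D := {d | ∃ a, d = Left a} ∪ {d | ∃ a, d = Right a}

theorem leftRight_ne_bot {d : D} : leftRight d ≠ ⊥ ↔ d ∈ leftOrRight := by
  induction d using cases_on <;>
    simp [leftRight, leftOrRight, Left, Right, Nil, Pair, Amb, Fun, bot_def, fold_inj]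

theorem ne_bot_of_mem_leftOrRight {d : D} (h : d ∈ leftOrRight) : d ≠ ⊥ := by
  rintro rfl; exact leftRight_ne_bot.2 h leftRight_bot

open Classical in
/-- The denotation of `introProg` as a function. -/
noncomputable def intro (c : D) : D :=
  if c ∈ (fun c => (ambParts c).1) ⁻¹' leftOrRight ∪ (fun c => (ambParts c).2) ⁻¹' leftOrRight then
    Amb (leftRight (ambParts c).1) (leftRight (ambParts c).2) else ⊥

theorem scottContinuous_ambParts_fst : ScottContinuous fun c => (ambParts c).1 :=
  ScottContinuous.comp scottContinuous_ambParts ScottContinuous.fst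

theorem scottContinuous_ambParts_snd : ScottContinuous fun c => (ambParts c).2 :=
  ScottContinuous.comp scottContinuous_ambParts ScottContinuous.snd

theorem scottContinuous_intro : ScottContinuous intro :=
  (((scottOpen_left.union scottOpen_right).preimage scottContinuous_ambParts_fst).union
    ((scottOpen_left.union scottOpen_right).preimage scottContinuous_ambParts_snd)).scottContinuous_ite
      (scottContinuous_amb
        (ScottContinuous.comp scottContinuous_ambParts_fst scottContinuous_leftRight)
        (ScottContinuous.comp scottContinuous_ambParts_snd scottContinuous_leftRight))

theorem intro_amb_of_mem {a b : D} (h : a ∈ leftOrRight ∨ b ∈ leftOrRight) :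
    intro (Amb a b) = Amb (leftRight a) (leftRight b) := by
  have h' : Amb a b ∈ (fun c => (ambParts c).1) ⁻¹' leftOrRight ∪
      (fun c => (ambParts c).2) ⁻¹' leftOrRight := by simpa using h
  rw [intro, if_pos h', ambParts_amb]

theorem intro_eq_bot {c : D}
    (h : ∀ a b, c = Amb a b → a ∉ leftOrRight ∧ b ∉ leftOrRight) : intro c = ⊥ := by
  refine if_neg ?_
  by_cases hc : ∃ a b, c = Amb a b
  · obtain ⟨a, b, rfl⟩ := hc
    simpa [not_or] using h a b rfl
  · have := ambParts_eq_bot fun a b e => hc ⟨a, b, e⟩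
    rintro (h | h)
    · exact ne_bot_of_mem_leftOrRight h (by simp [this])
    · exact ne_bot_of_mem_leftOrRight h (by simp [this])

open Classical in
/-- `Amb(a, b) ↦ Amb(f↓a, f↓b)`. -/
noncomputable def mapAmb (c f : D) : D :=
  if c ∈ {d : D | ∃ a b, d = Amb a b} then
    Amb (strictApp f (ambParts c).1) (strictApp f (ambParts c).2) else ⊥

theorem scottContinuous_mapAmb_left (f : D) : ScottContinuous fun c => mapAmb c f :=
  scottOpen_amb.scottContinuous_ite (scottContinuous_amb
    (ScottContinuous.comp scottContinuous_ambParts_fst (scottContinuous_strictApp_right f))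
    (ScottContinuous.comp scottContinuous_ambParts_snd (scottContinuous_strictApp_right f)))

theorem scottContinuous_mapAmb_right (c : D) : ScottContinuous (mapAmb c) := by
  by_cases h : c ∈ {d : D | ∃ a b, d = Amb a b}
  · have e : mapAmb c = fun f =>
        Amb (strictApp f (ambParts c).1) (strictApp f (ambParts c).2) := funext fun f => if_pos h
    rw [e]
    exact scottContinuous_amb (scottContinuous_strictApp_left _) (scottContinuous_strictApp_left _)
  · have e : mapAmb c = Function.const D ⊥ := funext fun f => if_neg h
    rw [e]
    exact ScottContinuous.const _

theorem mapAmb_amb (a b f : D) : mapAmb (Amb a b) f = Amb (strictApp f a) (strictApp f b) := by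
  simp [mapAmb]

end D

namespace Prog

/-- `D.abs` returns a default value on discontinuous functions, so computing a double abstraction
requires continuity in each argument: once for the inner and once for the outer abstraction. -/
theorem denote_lam_lam {M : Prog} {η : ℕ → D} {F : D → D → D}
    (h : ∀ a b, M.denote (extend [b] (extend [a] η)) = F a b)
    (h1 : ∀ a, ScottContinuous (F a)) (h2 : ∀ b, ScottContinuous fun a => F a b) (a b : D) :
    D.app (D.app ((lam (lam M)).denote η) a) b = F a b := by
  have e : ∀ a, (lam M).denote (extend [a] η) = D.abs (F a) := fun a =>
    congrArg D.abs (funext fun b => h a b)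
  have e' : (lam (lam M)).denote η = D.abs fun a => D.abs (F a) :=
    congrArg D.abs (funext e)
  rw [e', D.app_abs (D.scottContinuous_abs h1 h2), D.app_abs (h1 a)]

theorem denote_lam {M : Prog} {η : ℕ → D} {F : D → D} (h : ∀ a, M.denote (extend [a] η) = F a)
    (h1 : ScottContinuous F) (a : D) : D.app ((lam M).denote η) a = F a := by
  have e : (lam M).denote η = D.abs F := congrArg D.abs (funext h)
  rw [e, D.app_abs h1]

theorem denote_strictApp (f a : Prog) (η : ℕ → D) :
    (strictApp f a).denote η = D.strictApp (f.denote η) (a.denote η) := by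
  by_cases h : a.denote η = ⊥
  · rw [denote_strictApp_of_eq_bot h, h, D.strictApp_bot]
  · rw [denote_strictApp_of_ne_bot h, D.strictApp_of_ne_bot _ h]

/-! The program `λ c. c` -/

theorem app_idProg (η : ℕ → D) (a : D) : D.app (idProg.denote η) a = a :=
  denote_lam (F := fun a => a) (fun _ => rfl) ScottContinuous.id a

theorem idProg_wf : idProg.Wf := trivial

theorem idProg_closed : idProg.ClosedAt 0 := Nat.zero_lt_one

/-! The program for the disjunction of restrictions -/

theorem denote_ambLR (M N : Prog) (η : ℕ → D) :
    (ambLR M N).denote η = D.ambLR (M.denote η, N.denote η) := by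
  by_cases h : (∃ a, M.denote η = D.Left a) ∨ ∃ b, N.denote η = D.Right b
  · have hm : ∃ i l, ((![.con (.pair (.left .var) .var), .con (.pair .var (.right .var))] :
        Fin 2 → Pat) i).Matches ((pair M N).denote η) l := by
      rcases h with ⟨a, h⟩ | ⟨b, h⟩
      · exact ⟨0, [a, N.denote η], _, _, [a], [N.denote η], rfl, ⟨a, h, rfl⟩, rfl, rfl⟩
      · exact ⟨1, [M.denote η, b], _, _, [M.denote η], [b], rfl, rfl, ⟨b, h, rfl⟩, rfl⟩
    obtain ⟨i, l, hi⟩ := hm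
    rw [ambLR, D.ambLR, if_pos (by simpa using h)]
    refine denote_case_of_matches hi fun j l hj => ?_
    have hl : l.length = 2 := by
      rw [Pat.Matches.length_eq hj]; fin_cases j <;> rfl
    rw [denote_shift _ _ hl]; rfl
  · rw [D.ambLR, if_neg (by simpa using h)]
    refine denote_case_of_not_matches fun i l hi => h ?_
    fin_cases i
    · obtain ⟨a, b, _, _, hab, ⟨a', h', -⟩, -⟩ := hi
      rw [denote, D.pair_inj] at hab
      exact .inl ⟨a', hab.1.trans h'⟩
    · obtain ⟨a, b, _, _, hab, -, ⟨b', h', -⟩, -⟩ := hi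
      rw [denote, D.pair_inj] at hab
      exact .inr ⟨b', hab.2.trans h'⟩

theorem app_orProg (η : ℕ → D) (a b : D) :
    D.app (D.app (orProg.denote η) a) b =
      D.ambLR (D.strictApp (D.abs D.Left) a, D.strictApp (D.abs D.Right) b) := by
  refine denote_lam_lam (F := fun a b => D.ambLR
    (D.strictApp (D.abs D.Left) a, D.strictApp (D.abs D.Right) b)) (fun a b => ?_)
    (fun a => ?_) (fun b => ?_) a b
  · rw [denote_ambLR, denote_strictApp, denote_strictApp]
    rfl
  · exact ScottContinuous.comp (ScottContinuous.prodMk (ScottContinuous.const _)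
      (D.scottContinuous_strictApp_right _)) D.scottContinuous_ambLR
  · exact ScottContinuous.comp (ScottContinuous.prodMk (D.scottContinuous_strictApp_right _)
      (ScottContinuous.const _)) D.scottContinuous_ambLR

theorem stablyWf_var (i : ℕ) : (var i).StablyWf := fun _ => trivial

theorem ambLR_wf {M N : Prog} (hM : M.StablyWf) (hN : N.StablyWf) : (ambLR M N).Wf := by
  refine ⟨⟨hM.wf, hN.wf⟩, fun _ => ⟨hM _, hN _⟩, fun i j => ?_⟩
  fin_cases i <;> fin_cases j <;> exact compatible_shift _ _ (amb M N)

theorem ambLR_closed {M N : Prog} {k : ℕ} (hM : M.ClosedAt k) (hN : N.ClosedAt k) :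
    (ambLR M N).ClosedAt k := by
  refine ⟨⟨hM, hN⟩, fun i => ?_⟩
  fin_cases i <;> exact ClosedAt.shift (M := amb M N) 2 ⟨hM, hN⟩

theorem orProg_wf : orProg.Wf :=
  ambLR_wf (stablyWf_strictApp (fun _ => trivial) fun _ => trivial)
    (stablyWf_strictApp (fun _ => trivial) fun _ => trivial)

theorem orProg_closed : orProg.ClosedAt 0 :=
  ambLR_closed (closedAt_strictApp (by simp [ClosedAt]) (by simp [ClosedAt]))
    (closedAt_strictApp (by simp [ClosedAt]) (by simp [ClosedAt]))

/-! The program for the introduction of a restriction -/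

theorem denote_case_amb {M N : Prog} {η : ℕ → D} {a b : D} (h : M.denote η = D.Amb a b) :
    (case M 1 ![.con (.amb .var .var)] ![N]).denote η = N.denote (extend [a, b] η) := by
  refine denote_case_of_matches (i := 0) (l := [a, b])
    ⟨a, b, [a], [b], h, rfl, rfl, rfl⟩ fun i l hi => ?_
  fin_cases i
  obtain ⟨a', b', la, lb, h', rfl, rfl, rfl⟩ := hi
  rw [h, D.amb_inj] at h'
  rw [← h'.1, ← h'.2]; rfl

theorem denote_case_amb_eq_bot {M N : Prog} {η : ℕ → D} (h : ∀ a b, M.denote η ≠ D.Amb a b) :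
    (case M 1 ![.con (.amb .var .var)] ![N]).denote η = ⊥ := by
  refine denote_case_of_not_matches fun i l hi => ?_
  fin_cases i
  obtain ⟨a, b, _, _, h', -⟩ := hi
  exact h a b h'

theorem app_leftRight (η : ℕ → D) (d : D) : D.app (leftRight.denote η) d = D.leftRight d := by
  refine denote_lam (fun d => ?_) D.scottContinuous_leftRight d
  by_cases hl : ∃ a, d = D.Left a
  · obtain ⟨a, rfl⟩ := hl
    refine (denote_case_of_matches (P := ![.con (.left .var), .con (.right .var)])
      (M := var 0) (η := extend [D.Left a] η) (i := 0) (l := [a]) ⟨a, rfl, rfl⟩ fun i l hi => ?_).trans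
      (D.leftRight_left a).symm
    fin_cases i
    · rfl
    · obtain ⟨b, h, -⟩ := hi
      exact absurd h D.left_ne_right
  by_cases hr : ∃ a, d = D.Right a
  · obtain ⟨a, rfl⟩ := hr
    refine (denote_case_of_matches (P := ![.con (.left .var), .con (.right .var)])
      (M := var 0) (η := extend [D.Right a] η) (i := 1) (l := [a]) ⟨a, rfl, rfl⟩ fun i l hi => ?_).trans
      (D.leftRight_right a).symm
    fin_cases i
    · obtain ⟨b, h, -⟩ := hi
      exact absurd h D.right_ne_left
    · rfl
  rw [D.leftRight_eq_bot (fun a h => hl ⟨a, h⟩) fun a h => hr ⟨a, h⟩]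
  refine denote_case_of_not_matches fun i l hi => ?_
  fin_cases i
  · obtain ⟨b, h, -⟩ := hi
    exact hl ⟨b, h⟩
  · obtain ⟨b, h, -⟩ := hi
    exact hr ⟨b, h⟩

theorem denote_mapLeftRight {M : Prog} {η : ℕ → D} {a b : D} (h : M.denote η = D.Amb a b) :
    (mapLeftRight M).denote η = D.Amb (D.leftRight a) (D.leftRight b) := by
  rw [mapLeftRight, denote_case_amb h]
  exact congrArg₂ D.Amb (app_leftRight _ _) (app_leftRight _ _)

theorem introProg_matches {d : D} :
    (∃ i l, ((![.con (.amb (.left .var) .var), .con (.amb (.right .var) .var),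
      .con (.amb .var (.left .var)), .con (.amb .var (.right .var))] : Fin 4 → Pat) i).Matches d l)
    ↔ ∃ a b, d = D.Amb a b ∧ (a ∈ D.leftOrRight ∨ b ∈ D.leftOrRight) := by
  constructor
  · rintro ⟨i, l, hi⟩
    fin_cases i
    · obtain ⟨a, b, _, _, h, ⟨a', ha, -⟩, -⟩ := hi
      exact ⟨a, b, h, .inl (.inl ⟨a', ha⟩)⟩
    · obtain ⟨a, b, _, _, h, ⟨a', ha, -⟩, -⟩ := hi
      exact ⟨a, b, h, .inl (.inr ⟨a', ha⟩)⟩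
    · obtain ⟨a, b, _, _, h, -, ⟨a', ha, -⟩, -⟩ := hi
      exact ⟨a, b, h, .inr (.inl ⟨a', ha⟩)⟩
    · obtain ⟨a, b, _, _, h, -, ⟨a', ha, -⟩, -⟩ := hi
      exact ⟨a, b, h, .inr (.inr ⟨a', ha⟩)⟩
  · rintro ⟨a, b, rfl, (⟨c, rfl⟩ | ⟨c, rfl⟩) | (⟨c, rfl⟩ | ⟨c, rfl⟩)⟩
    · exact ⟨0, [c, b], _, _, [c], [b], rfl, ⟨c, rfl, rfl⟩, rfl, rfl⟩
    · exact ⟨1, [c, b], _, _, [c], [b], rfl, ⟨c, rfl, rfl⟩, rfl, rfl⟩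
    · exact ⟨2, [a, c], _, _, [a], [c], rfl, rfl, ⟨c, rfl, rfl⟩, rfl⟩
    · exact ⟨3, [a, c], _, _, [a], [c], rfl, rfl, ⟨c, rfl, rfl⟩, rfl⟩

theorem app_introProg (η : ℕ → D) (c : D) : D.app (introProg.denote η) c = D.intro c := by
  refine denote_lam (fun c => ?_) D.scottContinuous_intro c
  by_cases h : ∃ a b, c = D.Amb a b ∧ (a ∈ D.leftOrRight ∨ b ∈ D.leftOrRight)
  · have hm := introProg_matches.2 h
    obtain ⟨a, b, rfl, h⟩ := h
    obtain ⟨i, l, hi⟩ := hm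
    rw [D.intro_amb_of_mem h]
    refine denote_case_of_matches hi fun j l hj => ?_
    have hl : l.length = 2 := by
      rw [Pat.Matches.length_eq hj]; fin_cases j <;> rfl
    refine denote_mapLeftRight ?_
    -- The two pattern variables occupy the indices 0 and 1, so index 2 is the argument of the
    -- abstraction.
    simp [denote, extend, hl]
  · rw [D.intro_eq_bot fun a b e => by
      rw [← not_or]; exact fun h' => h ⟨a, b, e, h'⟩]
    exact denote_case_of_not_matches fun i l hi => h (introProg_matches.1 ⟨i, l, hi⟩)

theorem leftRight_rename (f : ℕ → ℕ) : leftRight.rename f = leftRight := by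
  simp only [leftRight, rename, lam.injEq, case.injEq, heq_eq_eq, true_and]
  refine ⟨rfl, funext fun i => ?_⟩
  fin_cases i <;> rfl

theorem leftRight_wf : leftRight.Wf := by
  refine ⟨trivial, fun i => by fin_cases i <;> trivial, fun i j => ?_⟩
  fin_cases i <;> fin_cases j
  · exact compatible_self _ _
  · exact compatible_of_disjoint (fun M _ _ h => by
      cases M <;> simp_all [Pat.progMatch, CPat.progMatch]) _ _
  · exact compatible_of_disjoint (fun M _ _ h => by
      cases M <;> simp_all [Pat.progMatch, CPat.progMatch]) _ _
  · exact compatible_self _ _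

theorem leftRight_closed (k : ℕ) : leftRight.ClosedAt k := by
  refine ⟨Nat.succ_pos k, fun i => ?_⟩
  fin_cases i <;> trivial

theorem mapLeftRight_wf {M : Prog} (h : M.Wf) : (mapLeftRight M).Wf := by
  refine ⟨h, fun i => ?_, fun i j => ?_⟩
  · fin_cases i
    exact ⟨⟨leftRight_wf, trivial⟩, leftRight_wf, trivial⟩
  · rw [Subsingleton.elim i j]
    exact compatible_self _ _

theorem mapLeftRight_rename (M : Prog) (f : ℕ → ℕ) :
    (mapLeftRight M).rename f = mapLeftRight (M.rename f) := by
  simp only [mapLeftRight, rename, case.injEq, heq_eq_eq, true_and]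
  funext i
  fin_cases i
  simp [rename, leftRight_rename, liftRen, Pat.arity, CPat.arity]

theorem introProg_wf : introProg.Wf := by
  refine ⟨trivial, fun _ => mapLeftRight_wf trivial, fun i j => ?_⟩
  -- All four patterns bind exactly two variables, so their common body is one program weakened by
  -- two.
  have e : mapLeftRight (var 2) = (mapLeftRight (var 0)).shift 2 :=
    (mapLeftRight_rename (var 0) (· + 2)).symm
  simp only [e]
  fin_cases i <;> fin_cases j <;> exact compatible_shift _ _ (mapLeftRight (var 0))

theorem introProg_closed : introProg.ClosedAt 0 := by
  refine ⟨Nat.zero_lt_one, fun i => ⟨?_, fun j => ?_⟩⟩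
  · fin_cases i <;> simp [ClosedAt, Pat.arity, CPat.arity]
  · fin_cases j
    refine ⟨⟨leftRight_closed _, ?_⟩, leftRight_closed _, ?_⟩ <;>
      simp [ClosedAt, Pat.arity, CPat.arity]

/-! Programs for the remaining rules -/

/-- `λ a. λ b. Amb(a, b)` -/
def ambProg : Prog := lam (lam (amb (var 1) (var 0)))

theorem app_ambProg (η : ℕ → D) (a b : D) :
    D.app (D.app (ambProg.denote η) a) b = D.Amb a b :=
  denote_lam_lam (F := D.Amb) (fun _ _ => rfl)
    (fun a => D.scottContinuous_amb (ScottContinuous.const a) ScottContinuous.id)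
    (fun b => D.scottContinuous_amb ScottContinuous.id (ScottContinuous.const b)) a b

/-- `λ a. Amb(a, a)` -/
def returnProg : Prog := lam (amb (var 0) (var 0))

theorem app_returnProg (η : ℕ → D) (a : D) : D.app (returnProg.denote η) a = D.Amb a a :=
  denote_lam (F := fun a => D.Amb a a) (fun _ => rfl)
    (D.scottContinuous_amb ScottContinuous.id ScottContinuous.id) a

theorem app_lam_nil (η : ℕ → D) (c : D) : D.app ((lam nil).denote η) c = D.Nil :=
  denote_lam (F := Function.const D D.Nil) (fun _ => rfl) (ScottContinuous.const _) c

theorem app_lam_amb_nil (η : ℕ → D) (c : D) :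
    D.app ((lam (amb nil nil)).denote η) c = D.Amb D.Nil D.Nil :=
  denote_lam (F := Function.const D _) (fun _ => rfl) (ScottContinuous.const _) c

theorem app_lam_returnProg (η : ℕ → D) (c d : D) :
    D.app (D.app ((lam returnProg).denote η) c) d = D.Amb d d :=
  denote_lam_lam (F := fun _ d => D.Amb d d) (fun _ _ => rfl)
    (fun _ => D.scottContinuous_amb ScottContinuous.id ScottContinuous.id)
    (fun _ => ScottContinuous.const _) c d

/-- `λ c. λ f. case c of {Amb(a, b) → Amb(f↓a, f↓b)}` -/
def mapProg : Prog :=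
  lam (lam (case (var 1) 1 ![.con (.amb .var .var)]
    ![amb (strictApp (var 2) (var 0)) (strictApp (var 2) (var 1))]))

theorem app_mapProg (η : ℕ → D) (c f : D) :
    D.app (D.app (mapProg.denote η) c) f = D.mapAmb c f := by
  refine denote_lam_lam (fun c f => ?_) D.scottContinuous_mapAmb_right
    D.scottContinuous_mapAmb_left c f
  by_cases h : ∃ a b, c = D.Amb a b
  · obtain ⟨a, b, rfl⟩ := h
    rw [D.mapAmb_amb, denote_case_amb (a := a) (b := b) rfl, denote, denote_strictApp,
      denote_strictApp]
    rfl
  · rw [D.mapAmb, if_neg (show c ∉ {d : D | ∃ a b, d = D.Amb a b} from h)]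
    exact denote_case_amb_eq_bot fun a b e => h ⟨a, b, e⟩

theorem mapProg_wf : mapProg.Wf := by
  refine ⟨trivial, fun i => ?_, fun i j => ?_⟩
  · fin_cases i
    exact ⟨(stablyWf_strictApp (stablyWf_var 2) (stablyWf_var 0)).wf,
      (stablyWf_strictApp (stablyWf_var 2) (stablyWf_var 1)).wf⟩
  · rw [Subsingleton.elim i j]
    exact compatible_self _ _

theorem mapProg_closed : mapProg.ClosedAt 0 := by
  refine ⟨by simp [ClosedAt], fun i => ?_⟩
  fin_cases i
  exact ⟨closedAt_strictApp (by simp [ClosedAt, Pat.arity, CPat.arity])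
    (by simp [ClosedAt, Pat.arity, CPat.arity]),
    closedAt_strictApp (by simp [ClosedAt, Pat.arity, CPat.arity])
    (by simp [ClosedAt, Pat.arity, CPat.arity])⟩

end Prog

/-! ### Harrop formulas and productive formulas -/

/-- A subdomain contains the supremum of the empty set, and a fixed-point type is an intersection of
subdomains. -/
theorem Ty.bot_mem_interp {V : Type*} (τ : Ty V) {ζ : V → Set D} (hζ : ∀ X, IsSubdomain (ζ X)) :
    ⊥ ∈ τ.interp ζ := by
  have key : ∀ Z, IsSubdomain Z → (⊥ : D) ∈ Z := fun Z hZ =>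
    hZ.2 ∅ (Set.empty_subset _) _ isLUB_empty
  cases τ with
  | var X => exact key _ (hζ X)
  | fix X ρ => exact fun Z hZ _ => key Z hZ
  | _ => exact Or.inl rfl

theorem update_le_update_of_imp {V : Type*} {_ : DecidableEq V} {F F' : V → Prop} (h : F ≤ F')
    {X : V} {p q : Prop} (hpq : p → q) : Function.update F X p ≤ Function.update F' X q :=
  update_le_update_iff.2 ⟨hpq, fun Y _ => h Y⟩

variable {Sg : Signature.{u}}

mutual
theorem Fml.Harrop.type_eq {F : PVar Sg → Prop} : ∀ {A : Fml Sg}, A.Harrop F → A.type F = .one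
  | .eq _ _, _ => rfl
  | .app P _, h => Pred.Harrop.type_eq (P := P) h
  | .and _ _, h => by
    rw [Fml.type, if_pos h.2]
    exact Fml.Harrop.type_eq h.1
  | .imp A B, h => (if_pos h :)
  | .all _ A, h => Fml.Harrop.type_eq (A := A) h
  | .ex _ A, h => Fml.Harrop.type_eq (A := A) h

theorem Pred.Harrop.type_eq {F : PVar Sg → Prop} : ∀ {ar : List Sg.Srt} {P : Pred Sg ar},
    P.Harrop F → P.type F = .one
  | _, .var X, h => (if_pos h :)
  | _, .const _, _ => rfl
  | _, .abs _ A, h => Fml.Harrop.type_eq (A := A) h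
  | _, .mu _ _, h => (if_pos h :)
  | _, .nu _ _, h => (if_pos h :)
end

mutual
-- The flags enter the definition only positively, because premises of implications are not
-- inspected.
theorem Fml.Harrop.mono {F F' : PVar Sg → Prop} (hF : F ≤ F') :
    ∀ {A : Fml Sg}, A.Harrop F → A.Harrop F'
  | .eq _ _, _ => trivial
  | .app P _, h => Pred.Harrop.mono (P := P) hF h
  | .and _ _, h => ⟨Fml.Harrop.mono hF h.1, Fml.Harrop.mono hF h.2⟩
  | .imp _ B, h => Fml.Harrop.mono (A := B) hF h
  | .all _ A, h => Fml.Harrop.mono (A := A) hF h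
  | .ex _ A, h => Fml.Harrop.mono (A := A) hF h

theorem Pred.Harrop.mono {F F' : PVar Sg → Prop} (hF : F ≤ F') :
    ∀ {ar : List Sg.Srt} {P : Pred Sg ar}, P.Harrop F → P.Harrop F'
  | _, .var X, h => hF X h
  | _, .const _, _ => trivial
  | _, .abs _ A, h => Fml.Harrop.mono (A := A) hF h
  | _, .mu X P, h => Pred.Harrop.mono (P := P)
      (update_le_update_of_imp hF id) h
  | _, .nu X P, h => Pred.Harrop.mono (P := P)
      (update_le_update_of_imp hF id) h
end

variable {S : Struc.{u, v} Sg}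

theorem Meaning.ofHarrop_R_of_true {p : Prop} {m : Meaning} (h : p) (c : D) :
    (Meaning.ofHarrop p m).R c ↔ c = D.Nil ∧ m.H := by simp [Meaning.ofHarrop, h]

theorem Meaning.ofHarrop_R_of_false {p : Prop} {m : Meaning} (h : ¬ p) (c : D) :
    (Meaning.ofHarrop p m).R c ↔ m.R c := by simp [Meaning.ofHarrop, h]

theorem Fml.Harrop.realises_iff {F : PVar Sg → Prop} {e : OEnv S} {ρ : PEnv S} {A : Fml Sg}
    (h : A.Harrop F) (c : D) :
    (A.sem F e ρ).R c ↔ c = D.Nil ∧ (A.sem F e ρ).H := by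
  cases A with
  | or A B => exact h.elim
  | restr A B => exact h.elim
  | conc A => exact h.elim
  | eq t t' =>
    rw [Fml.sem]
    exact Meaning.ofHarrop_R_of_true trivial c
  | _ =>
    rw [Fml.sem]
    exact Meaning.ofHarrop_R_of_true h c

mutual
/-- `⊥` does not realise a productive formula which is not Harrop, even if the bound predicate
variables are regarded as constants. -/
theorem Fml.not_realises_bot_of_not_harrop {F b F' : PVar Sg → Prop} (hF : F ≤ F') (hb : b ≤ F')
    (e : OEnv S) (ρ : PEnv S) : ∀ {A : Fml Sg}, A.ProductiveAux F b → ¬ A.Harrop F' →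
      ¬ (A.sem F e ρ).R ⊥
  | .eq _ _, _, hn => absurd trivial hn
  | .app P ts, hp, hn => by
    rw [Fml.sem, Meaning.ofHarrop_R_of_false fun h => hn (Pred.Harrop.mono hF h)]
    exact Pred.not_realises_bot_of_not_harrop hF hb e ρ hp hn _
  | .and A B, hp, hn => by
    rw [Fml.sem, Meaning.ofHarrop_R_of_false fun h =>
      hn ⟨Fml.Harrop.mono hF h.1, Fml.Harrop.mono hF h.2⟩]
    dsimp only
    -- If one conjunct is Harrop, the realisers are those of the other conjunct, which then cannot
    -- be Harrop; otherwise a realiser is a pair.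
    split_ifs with hB hA
    · exact fun h => Fml.not_realises_bot_of_not_harrop hF hb e ρ (A := A) hp.1
        (fun hA => hn ⟨hA, Fml.Harrop.mono hF hB⟩) h.1
    · exact fun h => Fml.not_realises_bot_of_not_harrop hF hb e ρ (A := B) hp.2
        (fun hB => hn ⟨Fml.Harrop.mono hF hA, hB⟩) h.2
    · rintro ⟨x, y, h, -⟩
      exact D.bot_ne_pair h
  | .or A B, _, _ => by
    rw [Fml.sem]
    rintro (⟨x, h, -⟩ | ⟨x, h, -⟩)
    · exact D.bot_ne_left h
    · exact D.bot_ne_right h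
  | .imp A B, hp, hn => absurd (Fml.Harrop.mono (A := B) hF hp) hn
  | .all x A, hp, hn => by
    rw [Fml.sem, Meaning.ofHarrop_R_of_false fun h => hn (Fml.Harrop.mono (A := A) hF h)]
    obtain ⟨v⟩ := S.nonempty x.1
    exact fun h => Fml.not_realises_bot_of_not_harrop hF hb _ ρ (A := A) hp hn (h v)
  | .ex x A, hp, hn => by
    rw [Fml.sem, Meaning.ofHarrop_R_of_false fun h => hn (Fml.Harrop.mono (A := A) hF h)]
    rintro ⟨v, h⟩
    exact Fml.not_realises_bot_of_not_harrop hF hb _ ρ (A := A) hp hn h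
  | .restr _ _, hp, _ => hp.elim
  | .conc A, _, _ => by
    rw [Fml.sem]
    rintro ⟨x, y, h, -⟩
    exact D.bot_ne_amb h

theorem Pred.not_realises_bot_of_not_harrop {F b F' : PVar Sg → Prop} (hF : F ≤ F') (hb : b ≤ F')
    (e : OEnv S) (ρ : PEnv S) : ∀ {ar : List Sg.Srt} {P : Pred Sg ar}, P.ProductiveAux F b →
      ¬ P.Harrop F' → ∀ as, ¬ (P.sem F e ρ as).R ⊥
  | _, .var X, hp, hn, _ => absurd (hp.elim (hF X) (hb X)) hn
  | _, .const _, _, hn, _ => absurd trivial hn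
  | _, .abs _ A, hp, hn, _ => by
    rw [Pred.sem]
    exact Fml.not_realises_bot_of_not_harrop hF hb _ ρ (A := A) hp hn
  | _, .mu X P, hp, hn, as => by
    rw [Pred.sem]
    intro h
    -- The elements other than `⊥` form a pre-fixed point. The induction hypothesis applies to the
    -- body because `F'` treats `X` as a constant, whether or not `bodyFlags` does.
    refine h (fun _ c => c ≠ ⊥) (fun bs d hd => ?_) rfl
    rintro rfl
    exact Pred.not_realises_bot_of_not_harrop (P := P)
      (update_le_update_of_imp hF fun _ => trivial)
      (update_le_update_of_imp hb fun _ => trivial) e _ hp hn bs hd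
  | _, .nu X P, hp, hn, as => by
    rw [Pred.sem]
    rintro ⟨Z, hZ, h⟩
    -- One unfolding suffices: a member of a post-fixed point realises the body, and nothing has to
    -- be known about `Z`.
    exact Pred.not_realises_bot_of_not_harrop (P := P)
      (update_le_update_of_imp hF fun _ => trivial)
      (update_le_update_of_imp hb fun _ => trivial) e _ hp hn as (hZ _ _ h)
end

/-- Harrop formulas are realised by `Nil` only; the other productive formulas are covered by the
preceding induction. This provides the defined component that `⇊` demands in the return and
monotonicity rules. -/
theorem Fml.Productive.ne_bot {e : OEnv S} {ρ : PEnv S} {A : Fml Sg} (h : A.Productive) {c : D}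
    (hc : (A.sem (fun _ => False) e ρ).R c) : c ≠ ⊥ := by
  rintro rfl
  by_cases hA : A.Harrop fun _ => False
  · exact D.bot_ne_nil ((hA.realises_iff _).1 hc).1
  · exact Fml.not_realises_bot_of_not_harrop le_rfl le_rfl e ρ h hA hc

theorem Fml.IsHarrop.typeSet_eq {A : Fml Sg} (h : A.IsHarrop) (ρ : PEnv S) :
    A.typeSet ρ = {⊥, D.Nil} := by
  rw [Fml.typeSet, Fml.Harrop.type_eq h]; rfl

theorem Fml.IsHarrop.realises_iff {A : Fml Sg} (h : A.IsHarrop) {e : OEnv S} {ρ : PEnv S} {c : D} :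
    A.Realises e ρ c ↔ c = D.Nil ∧ A.HoldsH e ρ := by
  rw [Fml.Realises, h.typeSet_eq, Fml.Harrop.realises_iff h]
  refine ⟨fun h => h.2, fun h => ⟨?_, h⟩⟩
  rw [h.1]; exact Or.inr rfl

theorem Fml.bot_mem_typeSet {ρ : PEnv S} (hρ : ρ.Admissible) (A : Fml Sg) : ⊥ ∈ A.typeSet ρ :=
  Ty.bot_mem_interp _ hρ

/-- Falsity is Harrop since `X` counts as a constant within `μ (λ X. X)`, and an implication
inherits this from its conclusion. -/
theorem Fml.neg_isHarrop (A : Fml Sg) : A.neg.IsHarrop := by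
  simp [Fml.IsHarrop, Fml.neg, Fml.false, Fml.Harrop, Pred.Harrop]

theorem Fml.not_holdsH_false {F : PVar Sg → Prop} {e : OEnv S} {ρ : PEnv S} :
    ¬ ((Fml.false : Fml Sg).sem F e ρ).H := by
  rw [Fml.false, Fml.sem, Meaning.ofHarrop, Pred.sem]
  intro h
  -- The empty predicate is a pre-fixed point of the identity operator.
  refine h (fun _ => False) fun bs hb => ?_
  simp [Pred.sem, PEnv.setProp] at hb

theorem Fml.holdsH_neg {e : OEnv S} {ρ : PEnv S} {A : Fml Sg} :
    A.neg.HoldsH e ρ ↔ ¬ ∃ c, (A.sem (fun _ => False) e ρ).R c := by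
  rw [Fml.HoldsH, Fml.neg, Fml.sem, Meaning.ofHarrop]
  exact ⟨fun h hc => Fml.not_holdsH_false (h hc), fun h hc => absurd hc h⟩

/-! ### The rules for the concurrency modality -/

variable {e : OEnv S} {ρ : PEnv S}

-- Typed realisers of the modality, restrictions and disjunctions.

theorem Fml.realises_conc {A : Fml Sg} {c : D} :
    (Fml.conc A).Realises e ρ c ↔ ∃ x y, c = D.Amb x y ∧ x ∈ A.typeSet ρ ∧ y ∈ A.typeSet ρ ∧
      (x ≠ ⊥ ∨ y ≠ ⊥) ∧ (x ≠ ⊥ → A.Realises e ρ x) ∧ (y ≠ ⊥ → A.Realises e ρ y) := by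
  rw [Fml.Realises, Fml.sem]
  constructor
  · rintro ⟨-, x, y, h, hx, hy, h0, h1, h2⟩
    exact ⟨x, y, h, hx, hy, h0, fun h => ⟨hx, h1 h⟩, fun h => ⟨hy, h2 h⟩⟩
  · rintro ⟨x, y, h, hx, hy, h0, h1, h2⟩
    exact ⟨Or.inr ⟨x, hx, y, hy, h⟩, x, y, h, hx, hy, h0, fun h => (h1 h).2, fun h => (h2 h).2⟩

theorem Fml.realises_restr {A B : Fml Sg} {c : D} :
    (Fml.restr A B).Realises e ρ c ↔ c ∈ A.typeSet ρ ∧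
      ((∃ y, (B.sem (fun _ => False) e ρ).R y) → c ≠ ⊥) ∧ (c ≠ ⊥ → A.Realises e ρ c) := by
  rw [Fml.Realises, Fml.sem]
  constructor
  · rintro ⟨h, -, h1, h2⟩
    exact ⟨h, h1, fun h' => ⟨h, h2 h'⟩⟩
  · rintro ⟨h, h1, h2⟩
    exact ⟨h, h, h1, fun h => (h2 h).2⟩

theorem Fml.realises_or {A B : Fml Sg} {c : D} :
    (Fml.or A B).Realises e ρ c ↔
      (∃ x, c = D.Left x ∧ A.Realises e ρ x) ∨ ∃ y, c = D.Right y ∧ B.Realises e ρ y := by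
  rw [Fml.Realises, Fml.sem]
  constructor
  · rintro ⟨h, ⟨x, rfl, hx⟩ | ⟨x, rfl, hx⟩⟩
    · rcases h with h | ⟨a, ha, h⟩ | ⟨b, hb, h⟩
      · exact absurd h D.left_ne_bot
      · rw [D.left_inj] at h
        subst h
        exact .inl ⟨_, rfl, ha, hx⟩
      · exact absurd h D.left_ne_right
    · rcases h with h | ⟨a, ha, h⟩ | ⟨b, hb, h⟩
      · exact absurd h D.right_ne_bot
      · exact absurd h D.right_ne_left
      · rw [D.right_inj] at h
        subst h
        exact .inr ⟨_, rfl, hb, hx⟩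
  · rintro (⟨x, rfl, hx⟩ | ⟨x, rfl, hx⟩)
    · exact ⟨.inr (.inl ⟨x, hx.1, rfl⟩), .inl ⟨x, rfl, hx.2⟩⟩
    · exact ⟨.inr (.inr ⟨x, hx.1, rfl⟩), .inr ⟨x, rfl, hx.2⟩⟩

theorem Fml.mem_typeSet_or {A B : Fml Sg} {c : D} :
    c ∈ (Fml.or A B).typeSet ρ ↔
      c = ⊥ ∨ (∃ a ∈ A.typeSet ρ, c = D.Left a) ∨ ∃ b ∈ B.typeSet ρ, c = D.Right b := Iff.rfl

theorem Fml.amb_mem_typeSet_conc {A : Fml Sg} {a b : D} (ha : a ∈ A.typeSet ρ)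
    (hb : b ∈ A.typeSet ρ) : D.Amb a b ∈ (Fml.conc A).typeSet ρ := .inr ⟨a, ha, b, hb, rfl⟩

theorem Fml.realises_conc_amb {A : Fml Sg} {x y : D} (hx : x ∈ A.typeSet ρ) (hy : y ∈ A.typeSet ρ)
    (h : x ≠ ⊥ ∨ y ≠ ⊥) (h1 : x ≠ ⊥ → A.Realises e ρ x) (h2 : y ≠ ⊥ → A.Realises e ρ y) :
    (Fml.conc A).Realises e ρ (D.Amb x y) :=
  Fml.realises_conc.2 ⟨x, y, rfl, hx, hy, h, h1, h2⟩

/-- A realiser of `⇊(A)` has a component realising `A`. -/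
theorem Fml.exists_realises_of_conc {A : Fml Sg} {c : D} (h : (Fml.conc A).Realises e ρ c) :
    ∃ a, A.Realises e ρ a := by
  obtain ⟨x, y, -, -, -, h0 | h0, h1, h2⟩ := Fml.realises_conc.1 h
  · exact ⟨x, h1 h0⟩
  · exact ⟨y, h2 h0⟩

theorem Fml.not_isHarrop_conc (A : Fml Sg) : ¬ (Fml.conc A).IsHarrop := fun h => h.elim

theorem Fml.not_isHarrop_restr (A B : Fml Sg) : ¬ (Fml.restr A B).IsHarrop := fun h => h.elim

-- Rules with Harrop and non-Harrop premises.

section Rules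

variable {A : Fml Sg} {As : List (Fml Sg)} {C : Fml Sg} {d : D}

theorem typedRule_cons_of_isHarrop (h : A.IsHarrop) :
    TypedRule ρ (A :: As) C d ↔ TypedRule ρ As C d := by rw [TypedRule, if_pos h]

theorem typedRule_cons_of_not_isHarrop (h : ¬ A.IsHarrop) :
    TypedRule ρ (A :: As) C d ↔ ∀ a ∈ A.typeSet ρ, TypedRule ρ As C (D.app d a) := by
  rw [TypedRule, if_neg h]

theorem realisesRule_cons_of_isHarrop (h : A.IsHarrop) :
    RealisesRule e ρ (A :: As) C d ↔ (A.HoldsH e ρ → RealisesRule e ρ As C d) := by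
  rw [RealisesRule, if_pos h]

theorem realisesRule_cons_of_not_isHarrop (h : ¬ A.IsHarrop) :
    RealisesRule e ρ (A :: As) C d ↔
      ∀ a, A.Realises e ρ a → RealisesRule e ρ As C (D.app d a) := by
  rw [RealisesRule, if_neg h]

end Rules

theorem Fml.Realises.conc {A : Fml Sg} (h : A.Productive) {a : D}
    (ha : A.Realises e ρ a) : (Fml.conc A).Realises e ρ (D.Amb a a) :=
  Fml.realises_conc_amb ha.1 ha.1 (.inl (h.ne_bot ha.2)) (fun _ => ha) fun _ => ha

theorem Fml.IsHarrop.nil_mem_typeSet {A : Fml Sg} (h : A.IsHarrop) :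
    D.Nil ∈ A.typeSet ρ := by rw [h.typeSet_eq]; exact .inr rfl

namespace Prog

theorem RealisesRule.of_unary {M : Prog} {A C : Fml Sg} (hA : ¬ A.IsHarrop) (hM : M.Wf)
    (hc : M.ClosedAt 0)
    (h : ∀ (S : Struc.{u, v} Sg) (e : OEnv S) (ρ : PEnv S), ρ.Admissible → ∀ (η : ℕ → D) (a : D),
      (a ∈ A.typeSet ρ → D.app (M.denote η) a ∈ C.typeSet ρ) ∧
      (A.Realises e ρ a → C.Realises e ρ (D.app (M.denote η) a))) :
    M.RealisesRule.{u, v} [A] C := by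
  refine ⟨hM, hc, fun S e ρ hρ η => ⟨?_, ?_⟩⟩
  · rw [typedRule_cons_of_not_isHarrop hA]
    exact fun a => (h S e ρ hρ η a).1
  · rw [realisesRule_cons_of_not_isHarrop hA]
    exact fun a => (h S e ρ hρ η a).2

theorem RealisesRule.of_unary_of_isHarrop {M : Prog} {A B C : Fml Sg} (hA : ¬ A.IsHarrop)
    (hB : B.IsHarrop) (hM : M.Wf) (hc : M.ClosedAt 0)
    (h : ∀ (S : Struc.{u, v} Sg) (e : OEnv S) (ρ : PEnv S), ρ.Admissible → ∀ (η : ℕ → D) (a : D),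
      (a ∈ A.typeSet ρ → D.app (M.denote η) a ∈ C.typeSet ρ) ∧
      (A.Realises e ρ a → B.HoldsH e ρ → C.Realises e ρ (D.app (M.denote η) a))) :
    M.RealisesRule.{u, v} [A, B] C := by
  refine ⟨hM, hc, fun S e ρ hρ η => ⟨?_, ?_⟩⟩
  · rw [typedRule_cons_of_not_isHarrop hA]
    intro a ha
    rw [typedRule_cons_of_isHarrop hB]
    exact (h S e ρ hρ η a).1 ha
  · rw [realisesRule_cons_of_not_isHarrop hA]
    intro a ha
    rw [realisesRule_cons_of_isHarrop hB]
    exact (h S e ρ hρ η a).2 ha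

theorem RealisesRule.of_binary {M : Prog} {A B C : Fml Sg} (hA : ¬ A.IsHarrop)
    (hB : ¬ B.IsHarrop) (hM : M.Wf) (hc : M.ClosedAt 0)
    (h : ∀ (S : Struc.{u, v} Sg) (e : OEnv S) (ρ : PEnv S), ρ.Admissible →
      ∀ (η : ℕ → D) (a b : D),
      (a ∈ A.typeSet ρ → b ∈ B.typeSet ρ → D.app (D.app (M.denote η) a) b ∈ C.typeSet ρ) ∧
      (A.Realises e ρ a → B.Realises e ρ b →
        C.Realises e ρ (D.app (D.app (M.denote η) a) b))) :
    M.RealisesRule.{u, v} [A, B] C := by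
  refine ⟨hM, hc, fun S e ρ hρ η => ⟨?_, ?_⟩⟩
  · rw [typedRule_cons_of_not_isHarrop hA]
    intro a ha
    rw [typedRule_cons_of_not_isHarrop hB]
    exact fun b => (h S e ρ hρ η a b).1 ha
  · rw [realisesRule_cons_of_not_isHarrop hA]
    intro a ha
    rw [realisesRule_cons_of_not_isHarrop hB]
    exact fun b => (h S e ρ hρ η a b).2 ha

-- Realisers of the individual rules.

theorem idProg_realises_absorb (A B : Fml Sg) :
    idProg.RealisesRule.{u, v} [.conc (.restr A B)] (.conc A) := by
  refine .of_unary (Fml.not_isHarrop_conc _) idProg_wf idProg_closed fun S e ρ _ η c => ?_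
  rw [app_idProg]
  refine ⟨id, fun h => ?_⟩
  obtain ⟨x, y, rfl, hx, hy, h0, h1, h2⟩ := Fml.realises_conc.1 h
  exact Fml.realises_conc_amb hx hy h0 (fun h => (Fml.realises_restr.1 (h1 h)).2.2 h)
    fun h => (Fml.realises_restr.1 (h2 h)).2.2 h

theorem strictApp_left (a : D) :
    D.strictApp (D.abs D.Left) a = ⊥ ∧ a = ⊥ ∨
      D.strictApp (D.abs D.Left) a = D.Left a ∧ a ≠ ⊥ := by
  by_cases h : a = ⊥
  · exact .inl ⟨by rw [h, D.strictApp_bot], h⟩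
  · exact .inr ⟨by rw [D.strictApp_of_ne_bot _ h, D.app_abs D.scottContinuous_left], h⟩

theorem strictApp_right (a : D) :
    D.strictApp (D.abs D.Right) a = ⊥ ∧ a = ⊥ ∨
      D.strictApp (D.abs D.Right) a = D.Right a ∧ a ≠ ⊥ := by
  by_cases h : a = ⊥
  · exact .inl ⟨by rw [h, D.strictApp_bot], h⟩
  · exact .inr ⟨by rw [D.strictApp_of_ne_bot _ h, D.app_abs D.scottContinuous_right], h⟩

/-- `g a b` is `Amb(Left↓a, Right↓b)` if one of `a` and `b` is defined. -/
theorem app_orProg_cases (η : ℕ → D) (a b : D) :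
    ∃ u w, (u = ⊥ ∧ a = ⊥ ∨ u = D.Left a ∧ a ≠ ⊥) ∧ (w = ⊥ ∧ b = ⊥ ∨ w = D.Right b ∧ b ≠ ⊥) ∧
      (D.app (D.app (orProg.denote η) a) b = ⊥ ∧ a = ⊥ ∧ b = ⊥ ∨
        D.app (D.app (orProg.denote η) a) b = D.Amb u w ∧ (u ≠ ⊥ ∨ w ≠ ⊥)) := by
  refine ⟨_, _, strictApp_left a, strictApp_right b, ?_⟩
  rw [app_orProg, D.ambLR]
  rcases strictApp_left a with ⟨h1, ha⟩ | ⟨h1, ha⟩ <;>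
    rcases strictApp_right b with ⟨h2, hb⟩ | ⟨h2, hb⟩ <;> simp [h1, h2, ha, hb]

/-- A realiser of `B ∨ E` contains one of `B` or of `E`, which forces `a` or `b` to be defined and
hence the result to be an `Amb`. Its defined components come from defined `a` or `b`, which realise
`A` or `C` by the restrictions. -/
theorem orProg_realises_disj (A B C E : Fml Sg) :
    orProg.RealisesRule.{u, v} [.restr A B, .restr C E]
      (.restr (.conc (.or A C)) (.or B E)) := by
  refine .of_binary (Fml.not_isHarrop_restr _ _) (Fml.not_isHarrop_restr _ _) orProg_wf
    orProg_closed fun S e ρ _ η a b => ?_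
  obtain ⟨p, q, hp, hq, hr⟩ := app_orProg_cases η a b
  generalize D.app (D.app (orProg.denote η) a) b = r at hr
  have htyp : a ∈ A.typeSet ρ → b ∈ C.typeSet ρ →
      p ∈ (Fml.or A C).typeSet ρ ∧ q ∈ (Fml.or A C).typeSet ρ := by
    intro ha hb
    constructor
    · rcases hp with ⟨rfl, -⟩ | ⟨rfl, -⟩
      · exact .inl rfl
      · exact .inr (.inl ⟨a, ha, rfl⟩)
    · rcases hq with ⟨rfl, -⟩ | ⟨rfl, -⟩
      · exact .inl rfl
      · exact .inr (.inr ⟨b, hb, rfl⟩)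
  have htyp' : a ∈ A.typeSet ρ → b ∈ C.typeSet ρ →
      r ∈ (Fml.conc (.or A C)).typeSet ρ := by
    intro ha hb
    rcases hr with ⟨rfl, -⟩ | ⟨rfl, -⟩
    · exact .inl rfl
    · exact Fml.amb_mem_typeSet_conc (htyp ha hb).1 (htyp ha hb).2
  refine ⟨htyp', fun ha hb => ?_⟩
  obtain ⟨ha0, ha1, ha2⟩ := Fml.realises_restr.1 ha
  obtain ⟨hb0, hb1, hb2⟩ := Fml.realises_restr.1 hb
  refine Fml.realises_restr.2 ⟨htyp' ha0 hb0, ?_, ?_⟩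
  · rintro ⟨y, hy⟩
    rw [Fml.sem] at hy
    rcases hr with ⟨-, ha', hb'⟩ | ⟨rfl, -⟩
    · rcases hy with ⟨x, -, hx⟩ | ⟨x, -, hx⟩
      · exact absurd ha' (ha1 ⟨x, hx⟩)
      · exact absurd hb' (hb1 ⟨x, hx⟩)
    · exact D.amb_ne_bot
  · intro h
    rcases hr with ⟨h', -⟩ | ⟨rfl, h0⟩
    · exact absurd h' h
    · refine Fml.realises_conc_amb (htyp ha0 hb0).1 (htyp ha0 hb0).2 h0 (fun hp' => ?_)
        fun hq' => ?_
      · rcases hp with ⟨h, -⟩ | ⟨h, h'⟩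
        · exact absurd h hp'
        · exact Fml.realises_or.2 (.inl ⟨a, h, ha2 h'⟩)
      · rcases hq with ⟨h, -⟩ | ⟨h, h'⟩
        · exact absurd h hq'
        · exact Fml.realises_or.2 (.inr ⟨b, h, hb2 h'⟩)

/-- Nothing is required of `d`: its argument is discarded, and `⊥`, `Left Nil`, `Right Nil` all
belong to the sum of two unit types. -/
theorem leftRight_mem_typeSet {A₀ A₁ : Fml Sg} (h0 : A₀.IsHarrop) (h1 : A₁.IsHarrop) (d : D) :
    D.leftRight d ∈ (Fml.or A₀ A₁).typeSet ρ := by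
  rw [Fml.mem_typeSet_or, h0.typeSet_eq, h1.typeSet_eq, D.leftRight]
  split_ifs
  · exact .inr (.inl ⟨_, .inr rfl, rfl⟩)
  · exact .inr (.inr ⟨_, .inr rfl, rfl⟩)
  · exact .inl rfl

theorem mem_leftOrRight_of_mem_typeSet {A₀ A₁ : Fml Sg} {d : D}
    (h : d ∈ (Fml.or A₀ A₁).typeSet ρ) (hd : d ≠ ⊥) : d ∈ D.leftOrRight := by
  rcases h with h | ⟨a, -, h⟩ | ⟨a, -, h⟩
  · exact absurd h hd
  · exact .inl ⟨a, h⟩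
  · exact .inr ⟨a, h⟩

theorem intro_cases (c : D) : (D.intro c = ⊥ ∧
      ∀ a b, c = D.Amb a b → a ∉ D.leftOrRight ∧ b ∉ D.leftOrRight) ∨
    ∃ a b, c = D.Amb a b ∧ D.intro c = D.Amb (D.leftRight a) (D.leftRight b) ∧
      (a ∈ D.leftOrRight ∨ b ∈ D.leftOrRight) := by
  by_cases h : ∃ a b, c = D.Amb a b ∧ (a ∈ D.leftOrRight ∨ b ∈ D.leftOrRight)
  · obtain ⟨a, b, rfl, h⟩ := h
    exact .inr ⟨a, b, rfl, D.intro_amb_of_mem h, h⟩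
  · have h' : ∀ a b, c = D.Amb a b → a ∉ D.leftOrRight ∧ b ∉ D.leftOrRight := fun a b e => by
      rw [← not_or]; exact fun h' => h ⟨a, b, e, h'⟩
    exact .inl ⟨D.intro_eq_bot h', h'⟩

/-- A realiser of a disjunction of Harrop formulas, up to the arguments of `Left` and `Right`. -/
theorem leftRight_realises {A₀ A₁ : Fml Sg} (h0 : A₀.IsHarrop) (h1 : A₁.IsHarrop) {d : D}
    (hd : d ∈ D.leftOrRight)
    (h : (Fml.or A₀ A₁).Realises e ρ d ∨ A₀.HoldsH e ρ ∧ A₁.HoldsH e ρ) :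
    (Fml.or A₀ A₁).Realises e ρ (D.leftRight d) := by
  rw [Fml.realises_or] at h ⊢
  simp only [h0.realises_iff, h1.realises_iff] at h ⊢
  rcases hd with ⟨a, rfl⟩ | ⟨a, rfl⟩
  · have : A₀.HoldsH e ρ := by
      rcases h with (⟨x, -, -, hx⟩ | ⟨x, hx, -⟩) | h
      · exact hx
      · exact absurd hx D.left_ne_right
      · exact h.1
    exact .inl ⟨D.Nil, D.leftRight_left a, rfl, this⟩
  · have : A₁.HoldsH e ρ := by
      rcases h with (⟨x, hx, -⟩ | ⟨x, -, -, hx⟩) | h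
      · exact absurd hx D.right_ne_left
      · exact hx
      · exact h.2
    exact .inr ⟨D.Nil, D.leftRight_right a, rfl, this⟩

theorem typeSet_imp_of_isHarrop {B C : Fml Sg} (hB : B.IsHarrop) (hC : ¬ C.IsHarrop) :
    (Fml.imp B C).typeSet ρ = C.typeSet ρ := by
  have : (Fml.imp B C).type (fun _ => False) = C.type fun _ => False :=
    (if_neg hC).trans (if_pos hB)
  rw [Fml.typeSet, this, Fml.typeSet]

theorem realises_imp_of_isHarrop {B C : Fml Sg} (hB : B.IsHarrop) (hC : ¬ C.IsHarrop) {c : D} :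
    (Fml.imp B C).Realises e ρ c ↔
      c ∈ C.typeSet ρ ∧ (B.HoldsH e ρ → C.Realises e ρ c) := by
  rw [Fml.Realises, typeSet_imp_of_isHarrop hB hC, Fml.sem, Meaning.ofHarrop_R_of_false (p := C.Harrop _) hC]
  dsimp only
  rw [if_pos (show B.Harrop _ from hB)]
  exact ⟨fun h => ⟨h.1, fun h' => ⟨h.1, h.2.2 h'⟩⟩, fun h => ⟨h.1, h.1, fun h' => (h.2 h').2⟩⟩

/-- As `B` is Harrop, a realiser of the first premise is a `c` of the type of `⇊(A₀ ∨ A₁)` that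
realises it if `B` holds. The second premise is Harrop, so it supplies no argument, only the fact
that both `A₀` and `A₁` hold if `B` fails. -/
theorem introProg_realises_intro (A₀ A₁ B : Fml Sg) (h0 : A₀.IsHarrop) (h1 : A₁.IsHarrop)
    (hB : B.IsHarrop) :
    introProg.RealisesRule.{u, v} [.imp B (.conc (.or A₀ A₁)), .imp B.neg (.and A₀ A₁)]
      (.restr (.conc (.or A₀ A₁)) B) := by
  have hC : ¬ (Fml.conc (.or A₀ A₁)).IsHarrop := Fml.not_isHarrop_conc _
  refine .of_unary_of_isHarrop (A := .imp B (.conc (.or A₀ A₁))) hC ⟨h0, h1⟩ introProg_wf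
    introProg_closed fun S e ρ _ η c => ?_
  rw [app_introProg]
  have htyp : D.intro c ∈ (Fml.conc (.or A₀ A₁)).typeSet ρ := by
    rcases intro_cases c with ⟨h, -⟩ | ⟨a, b, -, h, -⟩
    · exact .inl h
    · rw [h]
      exact Fml.amb_mem_typeSet_conc (leftRight_mem_typeSet h0 h1 a) (leftRight_mem_typeSet h0 h1 b)
  refine ⟨fun _ => htyp, fun hc hn => ?_⟩
  rw [realises_imp_of_isHarrop hB hC] at hc
  have hn' : ¬ B.HoldsH e ρ → A₀.HoldsH e ρ ∧ A₁.HoldsH e ρ := by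
    intro hB'
    rw [Fml.HoldsH, Fml.sem, Meaning.ofHarrop] at hn
    have : B.neg.HoldsH e ρ := Fml.holdsH_neg.2 fun ⟨x, hx⟩ => hB' ((hB.realises_iff).1
      ⟨by rw [hB.typeSet_eq]; exact .inr ((Fml.Harrop.realises_iff hB x).1 hx).1, hx⟩).2
    have h := hn ⟨D.Nil, (Fml.Harrop.realises_iff B.neg_isHarrop _).2 ⟨rfl, this⟩⟩
    rwa [Fml.sem, Meaning.ofHarrop] at h
  refine Fml.realises_restr.2 ⟨htyp, ?_, ?_⟩
  · rintro ⟨y, hy⟩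
    have hB' : B.HoldsH e ρ := ((Fml.Harrop.realises_iff hB y).1 hy).2
    obtain ⟨a, b, rfl, ha, hb, h, -⟩ := Fml.realises_conc.1 (hc.2 hB')
    -- Typing alone turns a defined component into a `Left` or a `Right`, so one of the patterns
    -- matches.
    rw [D.intro_amb_of_mem (h.imp (mem_leftOrRight_of_mem_typeSet ha)
      (mem_leftOrRight_of_mem_typeSet hb))]
    exact D.amb_ne_bot
  · intro hne
    rcases intro_cases c with ⟨h, -⟩ | ⟨a, b, rfl, h, hab⟩
    · exact absurd h hne
    have key : (a ≠ ⊥ → (Fml.or A₀ A₁).Realises e ρ a ∨ A₀.HoldsH e ρ ∧ A₁.HoldsH e ρ) ∧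
        (b ≠ ⊥ → (Fml.or A₀ A₁).Realises e ρ b ∨ A₀.HoldsH e ρ ∧ A₁.HoldsH e ρ) := by
      -- A classical distinction that the program never makes: if `B` fails, the components of `c`
      -- may be arbitrary elements of the type, such as `Left ⊥`, yet their tags are correct.
      by_cases hB' : B.HoldsH e ρ
      · obtain ⟨a', b', hab', -, -, -, ha, hb⟩ := Fml.realises_conc.1 (hc.2 hB')
        rw [D.amb_inj] at hab'
        rw [hab'.1, hab'.2]
        exact ⟨fun h => .inl (ha h), fun h => .inl (hb h)⟩
      · exact ⟨fun _ => .inr (hn' hB'), fun _ => .inr (hn' hB')⟩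
    rw [h]
    refine Fml.realises_conc_amb (leftRight_mem_typeSet h0 h1 a) (leftRight_mem_typeSet h0 h1 b)
      (hab.imp D.leftRight_ne_bot.2 D.leftRight_ne_bot.2) (fun ha => ?_) fun hb => ?_
    · have ha' := D.leftRight_ne_bot.1 ha
      exact leftRight_realises h0 h1 ha' (key.1 (D.ne_bot_of_mem_leftOrRight ha'))
    · have hb' := D.leftRight_ne_bot.1 hb
      exact leftRight_realises h0 h1 hb' (key.2 (D.ne_bot_of_mem_leftOrRight hb'))

/-- If `C` has a realiser, the first restriction makes `a` defined; otherwise `Nil` realises `¬ C`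
and the second makes `b` defined. -/
theorem ambProg_realises_lem (A C : Fml Sg) :
    ambProg.RealisesRule.{u, v} [.restr A C, .restr A C.neg] (.conc A) := by
  refine .of_binary (Fml.not_isHarrop_restr _ _) (Fml.not_isHarrop_restr _ _) ⟨trivial, trivial⟩
    (by simp [ambProg, ClosedAt]) fun S e ρ _ η a b => ?_
  rw [app_ambProg]
  refine ⟨fun ha hb => Fml.amb_mem_typeSet_conc ha hb, fun ha hb => ?_⟩
  obtain ⟨ha0, ha1, ha2⟩ := Fml.realises_restr.1 ha
  obtain ⟨hb0, hb1, hb2⟩ := Fml.realises_restr.1 hb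
  refine Fml.realises_conc_amb ha0 hb0 ?_ ha2 hb2
  by_cases h : ∃ y, (C.sem (fun _ => False) e ρ).R y
  · exact .inl (ha1 h)
  · exact .inr (hb1 ⟨D.Nil,
      (Fml.Harrop.realises_iff C.neg_isHarrop _).2 ⟨rfl, Fml.holdsH_neg.2 h⟩⟩)

/-- A Harrop premise supplies no argument, so the constant `Amb(Nil, Nil)` takes the place of the
duplicating abstraction. -/
theorem exists_realises_return (A : Fml Sg) (hA : A.Productive) :
    ∃ M : Prog, M.RealisesRule.{u, v} [A] (.conc A) := by
  by_cases h : A.IsHarrop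
  · refine ⟨amb nil nil, ⟨trivial, trivial⟩, ⟨trivial, trivial⟩, fun S e ρ _ η => ⟨?_, ?_⟩⟩
    · rw [typedRule_cons_of_isHarrop h]
      exact Fml.amb_mem_typeSet_conc h.nil_mem_typeSet h.nil_mem_typeSet
    · rw [realisesRule_cons_of_isHarrop h]
      exact fun hH => (h.realises_iff.2 ⟨rfl, hH⟩).conc hA
  · refine ⟨returnProg, .of_unary h ⟨trivial, trivial⟩ (by simp [returnProg, ClosedAt])
      fun S e ρ _ η a => ?_⟩
    rw [app_returnProg]
    exact ⟨fun ha => Fml.amb_mem_typeSet_conc ha ha, fun ha => ha.conc hA⟩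

theorem exists_realises_harrop (A : Fml Sg) (hA : A.IsHarrop) :
    ∃ M : Prog, M.RealisesRule.{u, v} [.conc A] A := by
  refine ⟨lam nil, .of_unary (Fml.not_isHarrop_conc _) trivial trivial fun S e ρ _ η c => ?_⟩
  rw [app_lam_nil]
  refine ⟨fun _ => hA.nil_mem_typeSet, fun h => ?_⟩
  obtain ⟨a, ha⟩ := Fml.exists_realises_of_conc h
  exact hA.realises_iff.2 ⟨rfl, (hA.realises_iff.1 ha).2⟩

theorem strictApp_mem_typeSet (hρ : ρ.Admissible) {A B : Fml Sg} (hA : ¬ A.IsHarrop)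
    (hB : ¬ B.IsHarrop) {f a : D} (hf : f ∈ (Fml.imp A B).typeSet ρ) (ha : a ∈ A.typeSet ρ) :
    D.strictApp f a ∈ B.typeSet ρ := by
  have e : (Fml.imp A B).type (fun _ => False) =
      .arrow (A.type fun _ => False) (B.type fun _ => False) := (if_neg hB).trans (if_neg hA)
  rw [Fml.typeSet, e] at hf
  by_cases h : a = ⊥
  · rw [h, D.strictApp_bot]
    exact Fml.bot_mem_typeSet hρ B
  rw [D.strictApp_of_ne_bot _ h]
  rcases hf with rfl | ⟨g, rfl, hg⟩
  · rw [D.app_bot]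
    exact Fml.bot_mem_typeSet hρ B
  · rw [D.app_fun]
    exact hg a ha

theorem realises_app {A B : Fml Sg} (hA : ¬ A.IsHarrop) (hB : ¬ B.IsHarrop) {f a : D}
    (hf : (Fml.imp A B).Realises e ρ f) (ha : A.Realises e ρ a) :
    ((B.sem (fun _ => False) e ρ).R (D.app f a)) := by
  have h := hf.2
  rw [Fml.sem, Meaning.ofHarrop_R_of_false (p := B.Harrop _) hB] at h
  dsimp only at h
  rw [if_neg (show ¬ A.Harrop _ from hA)] at h
  exact h.2 a ha.2

/-- If `B` is Harrop, so is `A → B`, and `Amb(Nil, Nil)` works. If only `A` is Harrop, a realiser of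
`A → B` realises `B` once `A` holds, and it is duplicated. Otherwise `f` is mapped strictly over
both components, since `f ⊥` might be defined without realising `B`; productivity of `B` keeps the
image of a defined component defined. -/
theorem exists_realises_mon (A B : Fml Sg) (hBp : B.Productive) :
    ∃ M : Prog, M.RealisesRule.{u, v} [.conc A, .imp A B] (.conc B) := by
  have hc := Fml.not_isHarrop_conc A
  by_cases hB : B.IsHarrop
  · refine ⟨lam (amb nil nil), .of_unary_of_isHarrop hc hB ⟨trivial, trivial⟩ ⟨trivial, trivial⟩
      fun S e ρ _ η c => ?_⟩
    rw [app_lam_amb_nil]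
    refine ⟨fun _ => Fml.amb_mem_typeSet_conc hB.nil_mem_typeSet hB.nil_mem_typeSet,
      fun h hAB => ?_⟩
    obtain ⟨a, ha⟩ := Fml.exists_realises_of_conc h
    rw [Fml.HoldsH, Fml.sem, Meaning.ofHarrop] at hAB
    exact (hB.realises_iff.2 ⟨rfl, hAB ⟨a, ha.2⟩⟩).conc hBp
  by_cases hA : A.IsHarrop
  · refine ⟨lam returnProg, .of_binary hc hB ⟨trivial, trivial⟩
      (by simp [returnProg, ClosedAt]) fun S e ρ _ η c d => ?_⟩
    rw [app_lam_returnProg, typeSet_imp_of_isHarrop hA hB, realises_imp_of_isHarrop hA hB]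
    refine ⟨fun _ hd => Fml.amb_mem_typeSet_conc hd hd, fun h hd => ?_⟩
    obtain ⟨a, ha⟩ := Fml.exists_realises_of_conc h
    exact (hd.2 (hA.realises_iff.1 ha).2).conc hBp
  · refine ⟨mapProg, .of_binary hc hB mapProg_wf mapProg_closed fun S e ρ hρ η c f => ?_⟩
    rw [app_mapProg]
    constructor
    · rintro (rfl | ⟨a, ha, b, hb, rfl⟩) hf
      · exact .inl (by simp [D.mapAmb])
      · rw [D.mapAmb_amb]
        exact Fml.amb_mem_typeSet_conc (strictApp_mem_typeSet hρ hA hB hf ha)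
          (strictApp_mem_typeSet hρ hA hB hf hb)
    · intro h hf
      obtain ⟨a, b, rfl, ha, hb, h0, h1, h2⟩ := Fml.realises_conc.1 h
      have key : ∀ x, x ∈ A.typeSet ρ → (x ≠ ⊥ → A.Realises e ρ x) → x ≠ ⊥ →
          B.Realises e ρ (D.strictApp f x) := fun x hx hx' h =>
        ⟨strictApp_mem_typeSet hρ hA hB hf.1 hx, by
          rw [D.strictApp_of_ne_bot _ h]; exact realises_app hA hB hf (hx' h)⟩
      have hne : ∀ {x}, D.strictApp f x ≠ ⊥ → x ≠ ⊥ := by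
        rintro x hx rfl
        exact hx (D.strictApp_bot f)
      rw [D.mapAmb_amb]
      exact Fml.realises_conc_amb (strictApp_mem_typeSet hρ hA hB hf.1 ha)
        (strictApp_mem_typeSet hρ hA hB hf.1 hb)
        (h0.imp (fun h => hBp.ne_bot (key a ha h1 h).2) fun h => hBp.ne_bot (key b hb h2 h).2)
        (fun h => key a ha h1 (hne h)) fun h => key b hb h2 (hne h)

end Prog

theorem ConcRule.exists_realises {As : List (Fml Sg)} {C : Fml Sg} (h : ConcRule As C) :
    ∃ M : Prog, M.RealisesRule.{u, v} As C := by
  cases h with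
  | lem A C => exact ⟨_, Prog.ambProg_realises_lem A C⟩
  | ret A _ hA => exact Prog.exists_realises_return A hA
  | mon A B _ _ _ hB => exact Prog.exists_realises_mon A B hB
  | harrop A _ hA => exact Prog.exists_realises_harrop _ hA
  | absorb A B => exact ⟨_, Prog.idProg_realises_absorb A B⟩
  | disj A B C E => exact ⟨_, Prog.orProg_realises_disj A B C E⟩
  | intro A₀ A₁ B _ _ _ h0 h1 hB => exact ⟨_, Prog.introProg_realises_intro A₀ A₁ B h0 h1 hB⟩

/-! ### Soundness -/

/-- Induction on the premises, with `N` standing for the program of the rule already applied to the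
premises treated so far; hence `N` may contain the assumption variables. A Harrop premise adds no
application: its program only certifies that the premise holds. -/
theorem exists_realisesSequent_of_rule {K : Set (Struc.{u, v} Sg)} {Γ : List (Fml Sg)}
    {C : Fml Sg} : ∀ (As : List (Fml Sg)) (N : Prog), N.Wf → N.ClosedAt Γ.length →
      (∀ S ∈ K, ∀ (e : OEnv S) (ρ : PEnv S), ρ.Admissible → ∀ η : ℕ → D,
        ((∀ i (h : i < Γ.length), η i ∈ Γ[i].typeSet ρ) → TypedRule ρ As C (N.denote η)) ∧
        ((∀ i (h : i < Γ.length), Γ[i].Realises e ρ (η i)) →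
          RealisesRule e ρ As C (N.denote η))) →
      (∀ A ∈ As, ∃ M : Prog, M.RealisesSequent K ⟨Γ, A⟩) →
      ∃ M : Prog, M.RealisesSequent K ⟨Γ, C⟩
  | [], N, hN, hc, h, _ => ⟨N, hN, hc, h⟩
  | A :: As, N, hN, hc, h, hAs => by
    obtain ⟨M, hM, hMc, hMr⟩ := hAs A List.mem_cons_self
    have hAs' : ∀ A ∈ As, ∃ M : Prog, M.RealisesSequent K ⟨Γ, A⟩ :=
      fun B hB => hAs B (List.mem_cons_of_mem _ hB)
    by_cases hA : A.IsHarrop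
    · refine exists_realisesSequent_of_rule As N hN hc (fun S hS e ρ hρ η => ?_) hAs'
      have hr := h S hS e ρ hρ η
      rw [typedRule_cons_of_isHarrop hA, realisesRule_cons_of_isHarrop hA] at hr
      exact ⟨hr.1, fun hη => hr.2 hη (hA.realises_iff.1 ((hMr S hS e ρ hρ η).2 hη)).2⟩
    · refine exists_realisesSequent_of_rule As (.app N M) ⟨hN, hM⟩ ⟨hc, hMc⟩
        (fun S hS e ρ hρ η => ?_) hAs'
      have hr := h S hS e ρ hρ η
      rw [typedRule_cons_of_not_isHarrop hA, realisesRule_cons_of_not_isHarrop hA] at hr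
      have hm := hMr S hS e ρ hρ η
      exact ⟨fun hη => hr.1 hη _ (hm.1 hη), fun hη => hr.2 hη _ (hm.2 hη)⟩

theorem Calculus.exists_realisesSequent {K : Set (Struc.{u, v} Sg)} {R : Calculus Sg}
    (hR : R.Realisable K) {q : Sequent Sg} (h : R.withConc.Derivable q) :
    ∃ M : Prog, M.RealisesSequent K q := by
  induction h with
  | step ps q hq _ ih =>
    rcases hq with hq | ⟨Γ, As, C, hrule, rfl, rfl⟩
    · exact hR ps q hq ih
    · obtain ⟨N, hN, hc, h⟩ := hrule.exists_realises.{u, v}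
      refine exists_realisesSequent_of_rule As N hN (hc.mono (Nat.zero_le _))
        (fun S _ e ρ hρ η => ?_) fun A hA => ih _ (List.mem_map_of_mem hA)
      exact ⟨fun _ => (h S e ρ hρ η).1, fun _ => (h S e ρ hρ η).2⟩

end CFP

theorem mainTheorem8 (Sg : CFP.Signature.{u}) :
    (∀ A B : CFP.Fml Sg, A.Wf → B.Wf → A.Productive →
      CFP.Prog.idProg.RealisesRule.{u, v} [.conc (.restr A B)] (.conc A)) ∧
    (∀ A B C E : CFP.Fml Sg, A.Wf → B.Wf → C.Wf → E.Wf → A.Productive → C.Productive →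
      CFP.Prog.orProg.RealisesRule.{u, v} [.restr A B, .restr C E]
        (.restr (.conc (.or A C)) (.or B E))) ∧
    (∀ A₀ A₁ B : CFP.Fml Sg, A₀.Wf → A₁.Wf → B.Wf → A₀.IsHarrop → A₁.IsHarrop → B.IsHarrop →
      CFP.Prog.introProg.RealisesRule.{u, v}
        [.imp B (.conc (.or A₀ A₁)), .imp B.neg (.and A₀ A₁)]
        (.restr (.conc (.or A₀ A₁)) B)) ∧
    (∀ (As : List (CFP.Fml Sg)) (C : CFP.Fml Sg), CFP.ConcRule As C →
      ∃ M : CFP.Prog, M.RealisesRule.{u, v} As C) ∧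
    (∀ (K : Set (CFP.Struc.{u, v} Sg)) (R : CFP.Calculus Sg), R.Realisable K →
      ∀ q : CFP.Sequent Sg, R.withConc.Derivable q →
        ∃ M : CFP.Prog, M.RealisesSequent K q) :=
  ⟨fun A B _ _ _ => CFP.Prog.idProg_realises_absorb A B,
    fun A B C E _ _ _ _ _ _ => CFP.Prog.orProg_realises_disj A B C E,
    fun A₀ A₁ B _ _ _ => CFP.Prog.introProg_realises_intro A₀ A₁ B,
    fun _ _ h => h.exists_realises,
    fun _ _ hR _ h => CFP.Calculus.exists_realisesSequent hR h⟩
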